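/- **Setting.** Let $n,k\ge 0$, $l\ge1$, let $\Gamma_0,\Gamma_1\in\mathbb R^{n\times n}$, $\Psi\in\mathbb R^{n\times l}$, $\Pi\in\mathbb R^{n\times k}$, and let $z$ be an $l$-dimensional i.i.d. process with mean zero and finite, positive definite variance matrix. A *solution* of the linear rational expectations model (LREM) $$\Gamma_0y(t)=\Gamma_1y(t-1)+\Psi z(t)+\Pi\eta(t),\qquad t\in\mathbb Z,\tag{1}$$ is a pair $(y,\eta)$ of processes of dimensions $n$ and $k$ such that $y(t)$ and $\eta(t)$ are measurable with respect to $z(t),z(t-1),\dots$ for all $t$, $E(\eta(t+1)\mid z(t),z(t-1),\dots)=0$ for all $t$, $(z,y,\eta)$ is jointly covariance stationary, and (1) holds almost surely. Let $W$ be a bounded measurable function on $(-\pi,\pi]$ whose values are Hermitian positive semidefinite $n\times n$ matrices, with $W(\omega)^*=W(-\omega)'$. A *regularized solution* is a solution $(y,\eta)$ that minimizes, among all solutions, $$\mathscr L=\tfrac12\,\mathrm{tr}\Big(\tfrac1{2\pi}\int_{-\pi}^{\pi}W(\omega)f(\omega)\,d\omega\Big),$$ where $f(\omega)=\sum_{h\in\mathbb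 Z}E\big[(y(h)-Ey(h))(y(0)-Ey(0))'\big]e^{-\mathrm ih\omega}$ is the spectral density of $y$. A regularized solution $(y,\eta)$ is *unique* if every regularized solution $(\tilde y,\tilde\eta)$ satisfies $\tilde y(t)=y(t)$ almost surely for all $t$. **Theorem.** Assume that $\det(\Gamma_0+\Gamma_1x)\ne0$ for all $x\in\mathbb C$ with $|x|=1$. Then there are orthogonal matrices $Q,Z$ with $$Q\Gamma_0Z=\begin{bmatrix}\Lambda_{11}&\Lambda_{12}\\0&\Lambda_{22}\end{bmatrix},\qquad Q\Gamma_1Z=\begin{bmatrix}\Omega_{11}&\Omega_{12}\\0&\Omega_{22}\end{bmatrix}$$ (conformable partitions), where all zeros of $\det(\Lambda_{11}+\Omega_{11}x)$ lie outside the unit circle, $\Omega_{22}$ is nonsingular, and all zeros of $\det(\Lambda_{22}+\Omega_{22}x)$ lie inside the unit circle. For any such matrices, let $Q_{1\cdot},Q_{2\cdot}$ be the corresponding blocks of rows of $Q$, let $K$ be any matrix whose columns form a basis of $\ker(Q_{2\cdot}\Pi)$, let $\dagger$ denote the Moore–Penrose inverse, and put $$\Theta_1=Z\begin{bmatrix}\Lambda_{11}^{-1}\Omega_{11}&0\\0&0\end{bmatrix}Z',\quad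 \Theta_z=Z\begin{bmatrix}\Lambda_{11}^{-1}(Q_{1\cdot}\Psi-Q_{1\cdot}\Pi(Q_{2\cdot}\Pi)^\dagger Q_{2\cdot}\Psi)\\0\end{bmatrix},\quad \Theta_\nu=Z\begin{bmatrix}\Lambda_{11}^{-1}Q_{1\cdot}\Pi\\0\end{bmatrix}K,$$ $$\Xi=\frac1{2\pi}\int_{-\pi}^{\pi}(I-\Theta_1'e^{\mathrm i\omega})^{-1}W(\omega)(I-\Theta_1e^{-\mathrm i\omega})^{-1}\,d\omega .$$ 1. A regularized solution exists if and only if $\mathrm{im}(Q_{2\cdot}\Psi)\subseteq\mathrm{im}(Q_{2\cdot}\Pi)$. 2. A regularized solution is unique if (a) $\ker(Q_{2\cdot}\Pi)\subseteq\ker(Q_{1\cdot}\Pi)$ or (b) $\Theta_\nu'\Xi\Theta_\nu$ is invertible. Conversely, if $\Pi$ has full column rank (no redundant expectation errors) and a regularized solution is unique, then (a) or (b) holds. 3. In case (a), every regularized solution $(y,\eta)$ satisfies $y(t)=\Theta_1y(t-1)+\Theta_zz(t)$ almost surely for all $t$, and $y$ together with $\eta(t)=-(Q_{2\cdot}\Pi)^\dagger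 Q_{2\cdot}\Psi z(t)$ is a regularized solution; if $\Pi$ has full column rank, this $\eta$ is the only one. 4. In case (b), every regularized solution $(y,\eta)$ satisfies, almost surely for all $t$, $$y(t)=\Theta_1y(t-1)+\Theta_{\mathrm{reg}}z(t),\qquad \eta(t)=-\big(K(\Theta_\nu'\Xi\Theta_\nu)^{-1}\Theta_\nu'\Xi\Theta_z+(Q_{2\cdot}\Pi)^\dagger Q_{2\cdot}\Psi\big)z(t),$$ where $\Theta_{\mathrm{reg}}=(I-\Theta_\nu(\Theta_\nu'\Xi\Theta_\nu)^{-1}\Theta_\nu'\Xi)\Theta_z$. -/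

import Mathlib

open MeasureTheory ProbabilityTheory
open scoped Matrix ComplexOrder

noncomputable section

/-! ### Matrix preliminaries -/

/-- The Moore-Penrose generalized inverse `A† = (Aᵀ A)† Aᵀ` of a real matrix, where the
generalized inverse of the symmetric matrix `Aᵀ A = U diag(d) Uᵀ` is `U diag(d⁻¹) Uᵀ` with the
convention `0⁻¹ = 0`. The four Penrose equations, which characterize `A†`, are proved below. -/
def pinv {m n : ℕ} (A : Matrix (Fin m) (Fin n) ℝ) : Matrix (Fin n) (Fin m) ℝ :=
  let h : (Aᴴ * A).IsHermitian := Matrix.isHermitian_conjTranspose_mul_self A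
  (h.eigenvectorUnitary : Matrix (Fin n) (Fin n) ℝ) *
    Matrix.diagonal (fun i => (h.eigenvalues i)⁻¹) *
    (h.eigenvectorUnitary : Matrix (Fin n) (Fin n) ℝ)ᴴ * Aᴴ

/-- The Penrose equations, which determine the Moore-Penrose inverse uniquely. -/
theorem pinv_penrose {m n : ℕ} (A : Matrix (Fin m) (Fin n) ℝ) :
    A * pinv A * A = A ∧ pinv A * A * pinv A = pinv A ∧
      (A * pinv A)ᵀ = A * pinv A ∧ (pinv A * A)ᵀ = pinv A * A := by
  obtain ⟨X, hX, hBXB, hXBX, hXs, hP⟩ : ∃ X : Matrix (Fin n) (Fin n) ℝ,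
      X * (Aᴴ * A) = Aᴴ * A * X ∧ Aᴴ * A * X * (Aᴴ * A) = Aᴴ * A ∧
      X * (Aᴴ * A) * X = X ∧ Xᴴ = X ∧ pinv A = X * Aᴴ := by
    let h : (Aᴴ * A).IsHermitian := Matrix.isHermitian_conjTranspose_mul_self A
    let U : Matrix (Fin n) (Fin n) ℝ := h.eigenvectorUnitary
    let d := h.eigenvalues
    have hU : Uᴴ * U = 1 := (Matrix.mem_unitaryGroup_iff').1 h.eigenvectorUnitary.2
    have hB : Aᴴ * A = U * Matrix.diagonal d * Uᴴ := by
      have := h.spectral_theorem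
      simpa [Unitary.conjStarAlgAut_apply, Function.comp_def, U, d,
        Matrix.star_eq_conjTranspose] using this
    have key : ∀ a b : Fin n → ℝ, (U * Matrix.diagonal a * Uᴴ) * (U * Matrix.diagonal b * Uᴴ) =
        U * Matrix.diagonal (fun i => a i * b i) * Uᴴ := by
      intro a b
      rw [← Matrix.diagonal_mul_diagonal]
      calc _ = U * Matrix.diagonal a * (Uᴴ * U) * Matrix.diagonal b * Uᴴ := by
            simp only [Matrix.mul_assoc]
        _ = _ := by rw [hU]; simp only [Matrix.mul_assoc, Matrix.mul_one]
    refine ⟨U * Matrix.diagonal (fun i => (d i)⁻¹) * Uᴴ, ?_, ?_, ?_, ?_, rfl⟩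
    · rw [hB, key, key]; simp only [mul_comm]
    · rw [hB, key, key]
      congr 3; ext i; by_cases hd : d i = 0 <;> simp [hd]
    · rw [hB, key, key]
      congr 3; ext i; by_cases hd : d i = 0 <;> simp [hd]
    · simp [Matrix.mul_assoc]
  have hA : A * X * (Aᴴ * A) = A := by
    rw [← sub_eq_zero, ← Matrix.conjTranspose_mul_self_eq_zero]
    have e : (A * X * (Aᴴ * A) - A)ᴴ = Aᴴ * A * X * Aᴴ - Aᴴ := by
      simp only [Matrix.conjTranspose_sub, Matrix.conjTranspose_mul, hXs,
        Matrix.conjTranspose_conjTranspose, Matrix.mul_assoc]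
    have e2 : (Aᴴ * A * X * Aᴴ - Aᴴ) * A = 0 := by
      rw [Matrix.sub_mul, Matrix.mul_assoc _ Aᴴ A, hBXB, sub_self]
    have e3 : A * X * (Aᴴ * A) - A = A * (X * (Aᴴ * A) - 1) := by
      rw [Matrix.mul_sub, Matrix.mul_one, Matrix.mul_assoc]
    rw [e, e3, ← Matrix.mul_assoc, e2, Matrix.zero_mul]
  simp only [← Matrix.conjTranspose_eq_transpose_of_trivial]
  rw [hP]
  refine ⟨by simpa only [Matrix.mul_assoc] using hA, ?_, ?_, ?_⟩
  · calc X * Aᴴ * A * (X * Aᴴ) = X * (Aᴴ * A) * X * Aᴴ := by simp only [Matrix.mul_assoc]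
      _ = _ := by rw [hXBX]
  · simp only [Matrix.conjTranspose_mul, hXs, Matrix.conjTranspose_conjTranspose,
      Matrix.mul_assoc]
  · rw [Matrix.mul_assoc, hX]
    simp only [Matrix.conjTranspose_mul, hXs, Matrix.conjTranspose_conjTranspose]
    rw [hX]

/-- The image (column space) of a real matrix. -/
abbrev matIm {p q : Type*} [Fintype q] (A : Matrix p q ℝ) : Submodule ℝ (p → ℝ) :=
  LinearMap.range A.mulVecLin

/-- The kernel (null space) of a real matrix. -/
abbrev matKer {p q : Type*} [Fintype q] (A : Matrix p q ℝ) : Submodule ℝ (q → ℝ) :=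
  LinearMap.ker A.mulVecLin

/-- The columns of `K` form a basis of the kernel of `A`. -/
def IsKerBasis {p q s : Type*} [Fintype q] (A : Matrix p q ℝ) (K : Matrix q s ℝ) : Prop :=
  LinearIndependent ℝ (fun j => K.col j) ∧ Submodule.span ℝ (Set.range fun j => K.col j) = matKer A

/-- A real matrix viewed as a complex one. -/
abbrev toC {p q : Type*} (A : Matrix p q ℝ) : Matrix p q ℂ := A.map Complex.ofReal

/-- The integral over `(-π, π]` of a matrix-valued function, entry by entry. -/
def matIntegral {p q : Type*} (F : ℝ → Matrix p q ℂ) : Matrix p q ℂ :=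
  Matrix.of fun i j => ∫ ω in (-Real.pi)..Real.pi, F ω i j

/-! ### The model and its solutions -/

/-- The coefficients of the formal linear rational expectations model
`Γ₀ y(t) = Γ₁ y(t-1) + Ψ z(t) + Π η(t)`, `t ∈ ℤ`. -/
structure LREM (n l k : ℕ) where
  Γ₀ : Matrix (Fin n) (Fin n) ℝ
  Γ₁ : Matrix (Fin n) (Fin n) ℝ
  Ψ : Matrix (Fin n) (Fin l) ℝ
  Pi : Matrix (Fin n) (Fin k) ℝ

section Processes

variable {S : Type*} [MeasurableSpace S]

/-- `z` is an i.i.d. process with mean zero and finite, positive definite variance matrix. -/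
structure IsShock {l : ℕ} (μ : Measure S) (z : ℤ → S → Fin l → ℝ) : Prop where
  measurable : ∀ t, Measurable (z t)
  indep : iIndepFun z μ
  ident : ∀ s t, IdentDistrib (z s) (z t) μ μ
  memLp : ∀ t i, MemLp (fun x => z t x i) 2 μ
  mean_zero : ∀ t i, ∫ x, z t x i ∂μ = 0
  posDef : ∀ t, (Matrix.of fun i j => cov[fun x => z t x i, fun x => z t x j; μ]).PosDef

/-- The sigma-algebra generated by `z(t), z(t-1), …`. -/
@[reducible] def past {l : ℕ} (z : ℤ → S → Fin l → ℝ) (t : ℤ) : MeasurableSpace S :=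
  ⨆ s ≤ t, MeasurableSpace.comap (z s) inferInstance

/-- Covariance stationarity of a vector process: finite second moments, a mean that does not
depend on time, and covariances that are invariant under shifts of time. -/
structure CovStationary {ι : Type*} (μ : Measure S) (x : ℤ → S → ι → ℝ) : Prop where
  memLp : ∀ t i, MemLp (fun a => x t a i) 2 μ
  mean : ∀ s t i, ∫ a, x s a i ∂μ = ∫ a, x t a i ∂μ
  cov : ∀ s t h i j, cov[fun a => x (s + h) a i, fun a => x (t + h) a j; μ] =
    cov[fun a => x s a i, fun a => x t a j; μ]

/-- The pair `(y, η)` is a solution of the model driven by `z`. -/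
structure IsSolution {n l k : ℕ} (M : LREM n l k) (μ : Measure S) (z : ℤ → S → Fin l → ℝ)
    (y : ℤ → S → Fin n → ℝ) (η : ℤ → S → Fin k → ℝ) : Prop where
  y_measurable : ∀ t, Measurable[past z t] (y t)
  η_measurable : ∀ t, Measurable[past z t] (η t)
  η_mds : ∀ t, μ[η (t + 1) | past z t] =ᵐ[μ] 0
  stationary : CovStationary μ
    (fun t a => (Sum.elim (z t a) (Sum.elim (y t a) (η t a)) : Fin l ⊕ (Fin n ⊕ Fin k) → ℝ))
  equation : ∀ t, ∀ᵐ a ∂μ,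
    M.Γ₀ *ᵥ y t a = M.Γ₁ *ᵥ y (t - 1) a + M.Ψ *ᵥ z t a + M.Pi *ᵥ η t a

/-- `f` is the spectral density of the covariance stationary process `y`, normalized such that
`f(ω) = ∑ₕ γ(h) e^{-ihω}`, where `γ(h)` is the autocovariance matrix at lag `h`;
equivalently `γ(h) = (1/2π) ∫ f(ω) e^{ihω} dω`. -/
def IsSpectralDensity {n : ℕ} (μ : Measure S) (y : ℤ → S → Fin n → ℝ)
    (f : ℝ → Matrix (Fin n) (Fin n) ℂ) : Prop :=
  ∀ (ω : ℝ) (i j : Fin n), HasSum (fun h : ℤ => ((cov[fun a => y h a i, fun a => y 0 a j; μ] : ℝ) : ℂ) *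
    Complex.exp (-(Complex.I * h * ω))) (f ω i j)

/-- Admissible weights: bounded measurable functions on `(-π, π]` with Hermitian positive
semidefinite values and `W(-ω)` the complex conjugate of `W(ω)`. -/
structure IsWeight {n : ℕ} (W : ℝ → Matrix (Fin n) (Fin n) ℂ) : Prop where
  measurable : ∀ i j, Measurable fun ω => W ω i j
  bounded : ∃ C : ℝ, ∀ ω ∈ Set.Ioc (-Real.pi) Real.pi, ∀ i j, ‖W ω i j‖ ≤ C
  posSemidef : ∀ ω ∈ Set.Ioc (-Real.pi) Real.pi, (W ω).PosSemidef
  conj : ∀ ω ∈ Set.Ioo (-Real.pi) Real.pi, (W ω)ᴴ = (W (-ω))ᵀ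

/-- The loss `½ tr ((1/2π) ∫ W(ω) f(ω) dω)`. For an admissible weight and a spectral density the
trace is a real number. -/
def loss {n : ℕ} (W f : ℝ → Matrix (Fin n) (Fin n) ℂ) : ℝ :=
  1 / 2 * (((1 / (2 * Real.pi) : ℝ) : ℂ) • matIntegral fun ω => W ω * f ω).trace.re

/-- The pair `(y, η)` is a regularized solution: a solution that minimizes the loss among all
solutions of the model. -/
def IsRegularized {n l k : ℕ} (M : LREM n l k) (μ : Measure S) (z : ℤ → S → Fin l → ℝ)
    (W : ℝ → Matrix (Fin n) (Fin n) ℂ)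
    (y : ℤ → S → Fin n → ℝ) (η : ℤ → S → Fin k → ℝ) : Prop :=
  IsSolution M μ z y η ∧ ∃ f, IsSpectralDensity μ y f ∧
    ∀ y' η' f', IsSolution M μ z y' η' → IsSpectralDensity μ y' f' → loss W f ≤ loss W f'

/-- A regularized solution with first component `y` is unique: every regularized solution has,
almost surely, the same first component. -/
def IsUniqueRegularized {n l k : ℕ} (M : LREM n l k) (μ : Measure S) (z : ℤ → S → Fin l → ℝ)
    (W : ℝ → Matrix (Fin n) (Fin n) ℂ) (y : ℤ → S → Fin n → ℝ) : Prop :=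
  ∀ y' η', IsRegularized M μ z W y' η' → ∀ t, y' t =ᵐ[μ] y t

end Processes

/-! ### The QZ decomposition and the matrices built from it -/

/-- An ordered real QZ decomposition of `(Γ₀, Γ₁)`: orthogonal `Q`, `Z` such that `Q Γ₀ Z` and
`Q Γ₁ Z` are conformably block upper triangular, all zeros of `det (Λ₁₁ + Ω₁₁ x)` lie outside the
unit circle, `Ω₂₂` is nonsingular, and all zeros of `det (Λ₂₂ + Ω₂₂ x)` lie inside.
The rows of `Q` and the columns of `Z` are indexed by the two blocks. -/
structure StableQZ {n l k : ℕ} (M : LREM n l k) (n₁ n₂ : ℕ) where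
  Q : Matrix (Fin n₁ ⊕ Fin n₂) (Fin n) ℝ
  Z : Matrix (Fin n) (Fin n₁ ⊕ Fin n₂) ℝ
  Λ₁₁ : Matrix (Fin n₁) (Fin n₁) ℝ
  Λ₁₂ : Matrix (Fin n₁) (Fin n₂) ℝ
  Λ₂₂ : Matrix (Fin n₂) (Fin n₂) ℝ
  Ω₁₁ : Matrix (Fin n₁) (Fin n₁) ℝ
  Ω₁₂ : Matrix (Fin n₁) (Fin n₂) ℝ
  Ω₂₂ : Matrix (Fin n₂) (Fin n₂) ℝ
  Q_orth : Qᵀ * Q = 1 ∧ Q * Qᵀ = 1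
  Z_orth : Zᵀ * Z = 1 ∧ Z * Zᵀ = 1
  eq_Γ₀ : Q * M.Γ₀ * Z = Matrix.fromBlocks Λ₁₁ Λ₁₂ 0 Λ₂₂
  eq_Γ₁ : Q * M.Γ₁ * Z = Matrix.fromBlocks Ω₁₁ Ω₁₂ 0 Ω₂₂
  zeros_outside : ∀ x : ℂ, (toC Λ₁₁ + x • toC Ω₁₁).det = 0 → 1 < ‖x‖
  Ω₂₂_nonsing : IsUnit Ω₂₂
  zeros_inside : ∀ x : ℂ, (toC Λ₂₂ + x • toC Ω₂₂).det = 0 → ‖x‖ < 1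

namespace StableQZ

variable {n l k n₁ n₂ r : ℕ} {M : LREM n l k}

/-- The first block of rows of `Q`. -/
abbrev Q₁ (D : StableQZ M n₁ n₂) : Matrix (Fin n₁) (Fin n) ℝ := D.Q.toRows₁

/-- The second block of rows of `Q`. -/
abbrev Q₂ (D : StableQZ M n₁ n₂) : Matrix (Fin n₂) (Fin n) ℝ := D.Q.toRows₂

/-- The condition `im (Q₂ Ψ) ⊆ im (Q₂ Π)`. -/
def ExistenceCondition (D : StableQZ M n₁ n₂) : Prop :=
  matIm (D.Q₂ * M.Ψ) ≤ matIm (D.Q₂ * M.Pi)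

/-- The condition `ker (Q₂ Π) ⊆ ker (Q₁ Π)`. -/
def UniquenessCondition (D : StableQZ M n₁ n₂) : Prop :=
  matKer (D.Q₂ * M.Pi) ≤ matKer (D.Q₁ * M.Pi)

/-- The matrix `Θ₁`. -/
def Θ₁ (D : StableQZ M n₁ n₂) : Matrix (Fin n) (Fin n) ℝ :=
  D.Z * (Matrix.fromBlocks (D.Λ₁₁⁻¹ * D.Ω₁₁) 0 0 0 : Matrix (Fin n₁ ⊕ Fin n₂) (Fin n₁ ⊕ Fin n₂) ℝ) *
    D.Zᵀ

/-- The matrix `Θ_z`. -/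
def Θz (D : StableQZ M n₁ n₂) : Matrix (Fin n) (Fin l) ℝ :=
  D.Z * Matrix.fromRows
    (D.Λ₁₁⁻¹ * (D.Q₁ * M.Ψ - D.Q₁ * M.Pi * pinv (D.Q₂ * M.Pi) * (D.Q₂ * M.Ψ)))
    (0 : Matrix (Fin n₂) (Fin l) ℝ)

/-- The matrix `Θ_ν`, for a given matrix `K` whose columns form a basis of `ker (Q₂ Π)`. -/
def Θν (D : StableQZ M n₁ n₂) (K : Matrix (Fin k) (Fin r) ℝ) : Matrix (Fin n) (Fin r) ℝ :=
  D.Z * Matrix.fromRows (D.Λ₁₁⁻¹ * (D.Q₁ * M.Pi)) (0 : Matrix (Fin n₂) (Fin k) ℝ) * K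

/-- The matrix `Ξ = (1/2π) ∫ (I - Θ₁' e^{iω})⁻¹ W(ω) (I - Θ₁ e^{-iω})⁻¹ dω`. Its entries are real
because `W(-ω)` is the complex conjugate of `W(ω)`, so it is recorded as a real matrix. -/
def Ξ (D : StableQZ M n₁ n₂) (W : ℝ → Matrix (Fin n) (Fin n) ℂ) : Matrix (Fin n) (Fin n) ℝ :=
  (((1 / (2 * Real.pi) : ℝ) : ℂ) • matIntegral fun ω =>
    (1 - Complex.exp (Complex.I * ω) • (toC D.Θ₁)ᵀ)⁻¹ * W ω *
      (1 - Complex.exp (-(Complex.I * ω)) • toC D.Θ₁)⁻¹).map Complex.re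

/-- The matrix `Θ_ν' Ξ Θ_ν`. -/
def gram (D : StableQZ M n₁ n₂) (W : ℝ → Matrix (Fin n) (Fin n) ℂ)
    (K : Matrix (Fin k) (Fin r) ℝ) : Matrix (Fin r) (Fin r) ℝ :=
  (D.Θν K)ᵀ * D.Ξ W * D.Θν K

/-- The impact matrix `Θ_reg = (I - Θ_ν (Θ_ν' Ξ Θ_ν)⁻¹ Θ_ν' Ξ) Θ_z`. -/
def Θreg (D : StableQZ M n₁ n₂) (W : ℝ → Matrix (Fin n) (Fin n) ℂ)
    (K : Matrix (Fin k) (Fin r) ℝ) : Matrix (Fin n) (Fin l) ℝ :=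
  (1 - D.Θν K * (D.gram W K)⁻¹ * (D.Θν K)ᵀ * D.Ξ W) * D.Θz

/-- The matrix `-(Q₂ Π)† Q₂ Ψ` that gives `η` in the standard solution. -/
def Hstd (D : StableQZ M n₁ n₂) : Matrix (Fin k) (Fin l) ℝ :=
  -(pinv (D.Q₂ * M.Pi) * (D.Q₂ * M.Ψ))

/-- The matrix `-(K (Θ_ν' Ξ Θ_ν)⁻¹ Θ_ν' Ξ Θ_z + (Q₂ Π)† Q₂ Ψ)` that gives `η` in the explicit
regularized solution. -/
def Hreg (D : StableQZ M n₁ n₂) (W : ℝ → Matrix (Fin n) (Fin n) ℂ)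
    (K : Matrix (Fin k) (Fin r) ℝ) : Matrix (Fin k) (Fin l) ℝ :=
  -(K * (D.gram W K)⁻¹ * (D.Θν K)ᵀ * D.Ξ W * D.Θz + pinv (D.Q₂ * M.Pi) * (D.Q₂ * M.Ψ))

end StableQZ

end

/-!
The theorem reduces the infinite-dimensional minimization over solutions to a finite-dimensional
least squares problem.

*Decomposition.* `P = Γ₀ + Γ₁` is invertible, and `A = P⁻¹ Γ₀` commutes with `P⁻¹ Γ₁ = 1 - A`, so a
zero `x` of the pencil corresponds to the eigenvalue `x / (x - 1)` of `A`, and `|x| > 1` to real part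
above `1/2`. The real characteristic polynomial of `A` factors accordingly, and orthonormal bases
adapted to the spectral subspace and to its image under `P` give `Z` and `Q` (`exists_stableQZ`).

*Form of a solution.* In the second block the model expresses `w(t) = Z₂ᵀ y(t)` as a stable linear
function of `w(t+1)` plus a martingale difference. Hence the covariance of `w(t)` with itself is
dampened by arbitrarily high powers of a stable matrix, and `w = 0` (`ae_eq_zero_of_forward`). What
is left is a restriction on `Ψ z + Π η` in the second block and a stable autoregression
`y(t) = Θ₁ y(t-1) + u(t)` with `u = Θ_z z + Θ_ν ν` (`IsSolution.reduced_form`,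
`IsSolution.y_eq_deviation`), where `ν` is a free martingale difference. The restriction is solvable
only under the existence condition, because the variance of `z` is positive definite. Conversely,
every linear `η(t) = H z(t)` that satisfies the restriction extends to a solution by the moving
average `∑ⱼ Θ₁ʲ B z(t-j)`; it is stationary because the law of the path of `z` is invariant under
shifts (`exists_isSolution`).

*Loss.* As `u` is white noise, the spectral density of `y` is
`(I - Θ₁ e^{-iω})⁻¹ V (I - Θ₁' e^{iω})⁻¹` with `V` the variance of `u`, and the loss is
`½ tr (Ξ V)` (`isSpectralDensity_autoregression`, `IsSchurStable.loss_arSpectrum`). With `Ξ = Rᵀ R`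
and `N` a solution of the normal equations `Θ_ν' Ξ (Θ_z + Θ_ν N) = 0`, the loss splits into a constant
and half the total variance of `R Θ_ν (ν - N z)` (`IsSolution.loss_eq`). So a solution is
regularized exactly when `Θ_ν' Ξ Θ_ν (ν - N z) = 0` (`IsSolution.isRegularized_iff`), and the
claims about existence, uniqueness and the explicit representations follow by linear algebra.
-/

noncomputable section

/-! ### Stable matrices and geometric series -/

theorem toC_mul {p q r : Type*} [Fintype q] (A : Matrix p q ℝ) (B : Matrix q r ℝ) :
    toC (A * B) = toC A * toC B :=
  Matrix.map_mul (f := Complex.ofRealHom)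

theorem toC_one {p : Type*} [DecidableEq p] : toC (1 : Matrix p p ℝ) = 1 :=
  Matrix.map_one _ Complex.ofReal_zero Complex.ofReal_one

theorem toC_pow {p : Type*} [Fintype p] [DecidableEq p] (A : Matrix p p ℝ) (j : ℕ) :
    toC (A ^ j) = toC A ^ j :=
  Matrix.map_pow A Complex.ofRealHom j

theorem toC_det {p : Type*} [Fintype p] [DecidableEq p] (A : Matrix p p ℝ) :
    (toC A).det = (A.det : ℂ) :=
  (RingHom.map_det Complex.ofRealHom A).symm

/-- A real square matrix is *stable* if all its complex eigenvalues lie in the open unit disc. -/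
def IsSchurStable {p : Type*} [Fintype p] [DecidableEq p] (A : Matrix p p ℝ) : Prop :=
  ∀ c : ℂ, (c • (1 : Matrix p p ℂ) - toC A).det = 0 → ‖c‖ < 1

section Norm
attribute [local instance] Matrix.linftyOpNormedRing Matrix.linftyOpNormedAlgebra
  Matrix.linftyOpNormedAddCommGroup

/-- Gelfand's formula turns the bound on the eigenvalues into geometric decay of the powers. -/
theorem IsSchurStable.exists_geometric_bound {p : Type*} [Fintype p] [DecidableEq p] {A : Matrix p p ℝ}
    (hA : IsSchurStable A) :
    ∃ C ρ : ℝ, 0 ≤ C ∧ 0 ≤ ρ ∧ ρ < 1 ∧ ∀ (j : ℕ) (i k : p), |(A ^ j) i k| ≤ C * ρ ^ j := by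
  have entry : ∀ (B : Matrix p p ℂ) i k, ‖B i k‖ ≤ ‖B‖ := by
    intro B i k
    have h1 : ‖B i k‖₊ ≤ ∑ j, ‖B i j‖₊ :=
      Finset.single_le_sum (f := fun j => ‖B i j‖₊) (fun _ _ => zero_le) (Finset.mem_univ k)
    have h2 : (∑ j, ‖B i j‖₊) ≤ ‖B‖₊ := by
      rw [Matrix.linfty_opNNNorm_def]
      exact Finset.le_sup (f := fun i => ∑ j, ‖B i j‖₊) (Finset.mem_univ i)
    exact_mod_cast h1.trans h2
  have hrad : spectralRadius ℂ (toC A) < 1 := by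
    have hsp : ∀ c ∈ spectrum ℂ (toC A), ‖c‖₊ < 1 := by
      intro c hc
      rw [spectrum.mem_iff, Matrix.isUnit_iff_isUnit_det, isUnit_iff_ne_zero, not_not,
        Algebra.algebraMap_eq_smul_one] at hc
      exact_mod_cast hA c hc
    rcases (spectrum ℂ (toC A)).eq_empty_or_nonempty with h | h
    · simp [spectralRadius, h]
    · exact_mod_cast spectrum.spectralRadius_lt_of_forall_lt_of_nonempty h hsp
  obtain ⟨ρ, hρ1, hρ2⟩ := ENNReal.lt_iff_exists_nnreal_btwn.1 hrad
  have hlim := spectrum.pow_nnnorm_pow_one_div_tendsto_nhds_spectralRadius (toC A)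
  have hev := hlim.eventually (gt_mem_nhds hρ1)
  obtain ⟨N, hN⟩ := Filter.eventually_atTop.1 hev
  have hρ2' : (ρ : ℝ) < 1 := by exact_mod_cast hρ2
  have hρ0 : 0 < (ρ : ℝ) := by
    have : (0 : ENNReal) < ρ := lt_of_le_of_lt zero_le hρ1
    exact_mod_cast this
  have hlarge : ∀ j, N + 1 ≤ j → ‖toC A ^ j‖ ≤ ρ ^ j := by
    intro j hj
    have h := (hN j (by omega)).le
    have hj0 : (j : ℝ) ≠ 0 := by
      have : j ≠ 0 := by omega
      exact_mod_cast this
    have h' := ENNReal.rpow_le_rpow h (Nat.cast_nonneg j : (0 : ℝ) ≤ j)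
    rw [← ENNReal.rpow_mul, one_div, inv_mul_cancel₀ hj0, ENNReal.rpow_one,
      ENNReal.rpow_natCast] at h'
    exact_mod_cast h'
  obtain ⟨g, hg⟩ : ∃ g : ℕ → ℝ, ∀ j, g j = ‖toC A ^ j‖ / (ρ : ℝ) ^ j := ⟨_, fun _ => rfl⟩
  have hg0 : ∀ j, 0 ≤ g j := fun j => by
    rw [hg]; exact div_nonneg (norm_nonneg _) (pow_nonneg hρ0.le _)
  have hG : 0 ≤ ∑ j ∈ Finset.range (N + 1), g j := Finset.sum_nonneg fun j _ => hg0 j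
  refine ⟨1 + ∑ j ∈ Finset.range (N + 1), g j, ρ, by linarith, hρ0.le, hρ2', ?_⟩
  intro j i k
  have h1 : |(A ^ j) i k| ≤ ‖toC A ^ j‖ := by
    have h := entry (toC A ^ j) i k
    have e : (toC A ^ j) i k = ((A ^ j) i k : ℝ) := by rw [← toC_pow]; rfl
    rwa [e, Complex.norm_real, Real.norm_eq_abs] at h
  have hpos : 0 < (ρ : ℝ) ^ j := pow_pos hρ0 j
  refine h1.trans ?_
  by_cases hj : N + 1 ≤ j
  · exact (hlarge j hj).trans (le_mul_of_one_le_left hpos.le (by linarith))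
  · have h2 : g j ≤ ∑ j ∈ Finset.range (N + 1), g j :=
      Finset.single_le_sum (f := g) (fun _ _ => hg0 _) (Finset.mem_range.2 (by omega))
    rw [hg, div_le_iff₀ hpos] at h2
    refine h2.trans (mul_le_mul_of_nonneg_right (by linarith) hpos.le)

end Norm

section Stable
variable {p : Type*} [Fintype p] [DecidableEq p] {A : Matrix p p ℝ}

theorem IsSchurStable.summable_abs (hA : IsSchurStable A) (i k : p) :
    Summable fun j : ℕ => |(A ^ j) i k| := by
  obtain ⟨C, ρ, hC, h0, h1, hb⟩ := hA.exists_geometric_bound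
  exact Summable.of_nonneg_of_le (fun _ => abs_nonneg _) (fun j => hb j i k)
    ((summable_geometric_of_lt_one h0 h1).mul_left C)

theorem IsSchurStable.tendsto_pow (hA : IsSchurStable A) (i k : p) :
    Filter.Tendsto (fun j : ℕ => (A ^ j) i k) Filter.atTop (nhds 0) :=
  (hA.summable_abs i k).of_abs.tendsto_atTop_zero

theorem IsSchurStable.isUnit_det (hA : IsSchurStable A) {c : ℂ} (hc : ‖c‖ = 1) :
    IsUnit (1 - c • toC A).det := by
  rw [isUnit_iff_ne_zero]
  intro h
  have hc0 : c ≠ 0 := by rintro rfl; simp at hc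
  have e : (1 - c • toC A) = c • (c⁻¹ • (1 : Matrix p p ℂ) - toC A) := by
    rw [smul_sub, smul_smul, mul_inv_cancel₀ hc0, one_smul]
  rw [e, Matrix.det_smul] at h
  have h2 := hA c⁻¹ ((mul_eq_zero.1 h).resolve_left (pow_ne_zero _ hc0))
  rw [norm_inv, hc] at h2
  norm_num at h2

theorem IsSchurStable.hasSum_geometric (hA : IsSchurStable A) {c : ℂ} (hc : ‖c‖ = 1) :
    HasSum (fun j : ℕ => c ^ j • toC A ^ j) (1 - c • toC A)⁻¹ := by
  have hs : Summable (fun j : ℕ => c ^ j • toC A ^ j) := by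
    refine Pi.summable.2 fun i => Pi.summable.2 fun k => ?_
    refine Summable.of_norm ?_
    have : (fun j : ℕ => ‖(c ^ j • toC A ^ j) i k‖) = fun j => |(A ^ j) i k| := by
      ext j
      rw [← toC_pow]
      simp [hc]
    rw [this]
    exact hA.summable_abs i k
  have e : (fun j : ℕ => c ^ j • toC A ^ j) = fun j : ℕ => (c • toC A) ^ j := by
    ext1 j; rw [smul_pow]
  rw [e] at hs ⊢
  rw [Matrix.inv_eq_right_inv (B := ∑' j : ℕ, (c • toC A) ^ j) hs.one_sub_mul_tsum_pow]
  exact hs.hasSum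

theorem IsSchurStable.isUnit_one_sub (hA : IsSchurStable A) : IsUnit (1 - A) := by
  have h := hA.isUnit_det (c := 1) (by simp)
  rw [one_smul, ← toC_one, ← Matrix.map_sub _ Complex.ofReal_sub, toC_det, isUnit_iff_ne_zero] at h
  rw [Matrix.isUnit_iff_isUnit_det, isUnit_iff_ne_zero]
  exact_mod_cast h

end Stable

/-! ### Real factors of the characteristic polynomial and adapted orthonormal bases -/

section Factorization
open Polynomial

/-- The complex roots of an irreducible real polynomial are `c` and its conjugate, so they have
the same real part. -/
theorem Irreducible.re_eq_of_aeval_eq_zero {q : ℝ[X]} (hq : Irreducible q) {a b : ℂ}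
    (ha : aeval a q = 0) (hb : aeval b q = 0) : a.re = b.re := by
  -- The real quadratic `(X - a) (X - ā)`.
  let s : ℝ[X] := X ^ 2 - C (2 * a.re) * X + C (a.re ^ 2 + a.im ^ 2)
  have hs : ∀ c : ℂ, aeval c s = (c - a) * (c - (starRingEnd ℂ) a) := by
    intro c
    apply Complex.ext <;> simp [s, pow_two] <;> ring
  have hdvd : q ∣ s := by
    by_contra hnd
    obtain ⟨u, v, huv⟩ := (hq.coprime_iff_not_dvd).2 hnd
    have := congrArg (aeval a) huv
    simp [ha, hs] at this
  obtain ⟨t, ht⟩ := hdvd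
  have h0 : (b - a) * (b - (starRingEnd ℂ) a) = 0 := by rw [← hs, ht]; simp [hb]
  rcases mul_eq_zero.1 h0 with h | h
  · rw [sub_eq_zero.1 h]
  · rw [sub_eq_zero.1 h, Complex.conj_re]

/-- Every nonzero real polynomial splits into a factor with all complex roots to the right of a
given vertical line and one with all roots on it or to its left. -/
theorem Polynomial.exists_factor_re (c : ℝ) (p : ℝ[X]) (hp : p ≠ 0) :
    ∃ p₁ p₂ : ℝ[X], p = p₁ * p₂ ∧ (∀ a : ℂ, aeval a p₁ = 0 → c < a.re) ∧
      ∀ a : ℂ, aeval a p₂ = 0 → a.re ≤ c := by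
  induction p using WfDvdMonoid.induction_on_irreducible with
  | zero => exact absurd rfl hp
  | unit u hu =>
    have key : ∀ w : ℝ[X], IsUnit w → ∀ a : ℂ, aeval a w ≠ 0 := fun w hw a =>
      (hw.map (aeval a)).ne_zero
    exact ⟨u, 1, (mul_one u).symm, fun a h => absurd h (key u hu a), fun a h => by simp at h⟩
  | mul p q hp0 hq ih =>
    obtain ⟨p₁, p₂, rfl, h₁, h₂⟩ := ih hp0
    by_cases hr : ∃ a : ℂ, aeval a q = 0 ∧ c < a.re
    · obtain ⟨a, ha, hac⟩ := hr
      refine ⟨q * p₁, p₂, by ring, fun b hb => ?_, h₂⟩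
      rw [map_mul] at hb
      rcases mul_eq_zero.1 hb with hb | hb
      · rwa [← hq.re_eq_of_aeval_eq_zero ha hb]
      · exact h₁ b hb
    · push Not at hr
      refine ⟨p₁, q * p₂, by ring, h₁, fun b hb => ?_⟩
      rw [map_mul] at hb
      rcases mul_eq_zero.1 hb with hb | hb
      · exact hr b hb
      · exact h₂ b hb

/-- A polynomial that annihilates a real matrix vanishes at its complex eigenvalues. -/
theorem aeval_eq_zero_of_eigenvector {m : Type*} [Fintype m] [DecidableEq m] {T : Matrix m m ℝ}
    {p : ℝ[X]} (hp : aeval T p = 0) {v : m → ℂ} (hv : v ≠ 0) {a : ℂ}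
    (ha : toC T *ᵥ v = a • v) : aeval a p = 0 := by
  have hpow : ∀ j : ℕ, toC (T ^ j) *ᵥ v = a ^ j • v := by
    intro j
    induction j with
    | zero => simp
    | succ j ih => rw [pow_succ, toC_mul, ← Matrix.mulVec_mulVec, ha, Matrix.mulVec_smul, ih,
        smul_smul, pow_succ, mul_comm]
  have key : ∀ q : ℝ[X], toC (aeval T q) *ᵥ v = aeval a q • v := by
    intro q
    induction q using Polynomial.induction_on' with
    | add q r hq hr =>
      rw [map_add, map_add, add_smul, ← hq, ← hr, ← Matrix.add_mulVec]
      congr 1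
      ext i k
      simp
    | monomial j b =>
      rw [← C_mul_X_pow_eq_monomial, map_mul, map_mul, map_pow, map_pow, aeval_X, aeval_X, aeval_C,
        aeval_C, ← Algebra.smul_def, mul_smul, ← hpow]
      have : toC (b • T ^ j) = (b : ℂ) • toC (T ^ j) := by ext i k; simp
      rw [this, Matrix.smul_mulVec]
      rfl
  have h := key p
  rw [hp] at h
  have h0 : aeval a p • v = 0 := by
    rw [← h]; ext i; simp [Matrix.mulVec, dotProduct]
  exact (smul_eq_zero.1 h0).resolve_right hv

/-- For a matrix `T` annihilated by `p`, the zeros `x` of `det (T + x (1 - T))` correspond to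
the eigenvalues `x / (x - 1)` of `T`. -/
theorem aeval_eq_zero_of_det_pencil {m : Type*} [Fintype m] [DecidableEq m] {T : Matrix m m ℝ}
    {p : ℝ[X]} (hp : aeval T p = 0) {x : ℂ} (hx : (toC T + x • toC (1 - T)).det = 0) :
    x ≠ 1 ∧ aeval (x / (x - 1)) p = 0 := by
  obtain ⟨v, hv, hv0⟩ := Matrix.exists_mulVec_eq_zero_iff.2 hx
  have e : toC (1 - T) = 1 - toC T := by
    rw [← toC_one]; exact Matrix.map_sub _ Complex.ofReal_sub _ _
  rw [e, Matrix.add_mulVec, Matrix.smul_mulVec, Matrix.sub_mulVec, Matrix.one_mulVec] at hv0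
  have hx1 : x ≠ 1 := by
    rintro rfl
    apply hv
    rw [← hv0, one_smul]; abel
  have hx2 : x - 1 ≠ 0 := sub_ne_zero.2 hx1
  refine ⟨hx1, aeval_eq_zero_of_eigenvector hp hv ?_⟩
  have h3 : (x - 1) • (toC T *ᵥ v) = x • v := by
    rw [← sub_eq_zero, ← neg_eq_zero.2 hv0]
    module
  rw [div_eq_inv_mul, mul_smul, ← h3, smul_smul, inv_mul_cancel₀ hx2, one_smul]

theorem re_div_sub_one_gt_half_iff {x : ℂ} (hx : x ≠ 1) :
    1 / 2 < (x / (x - 1)).re ↔ 1 < ‖x‖ := by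
  have h0 : 0 < Complex.normSq (x - 1) := Complex.normSq_pos.2 (sub_ne_zero.2 hx)
  rw [Complex.div_re, ← add_div, lt_div_iff₀ h0, ← one_lt_sq_iff₀ (norm_nonneg x),
    ← Complex.normSq_eq_norm_sq, Complex.normSq_apply, Complex.normSq_apply]
  simp only [Complex.sub_re, Complex.sub_im, Complex.one_re, Complex.one_im]
  constructor <;> intro h <;> nlinarith

end Factorization

/-- An orthogonal matrix whose first columns span a given subspace. -/
theorem exists_orthogonal_of_submodule {n : ℕ} (V : Submodule ℝ (EuclideanSpace ℝ (Fin n)))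
    {n₁ n₂ : ℕ} (h₁ : Module.finrank ℝ V = n₁) (h₂ : n₁ + n₂ = n) :
    ∃ Z : Matrix (Fin n) (Fin n₁ ⊕ Fin n₂) ℝ, Zᵀ * Z = 1 ∧ Z * Zᵀ = 1 ∧
      (∀ j, WithLp.toLp 2 (fun i => Z i (Sum.inl j)) ∈ V) ∧
      ∀ v ∈ V, Z.toCols₂ᵀ *ᵥ v.ofLp = 0 := by
  have h₂' : Module.finrank ℝ Vᗮ = n₂ := by
    have := V.finrank_add_finrank_orthogonal
    rw [finrank_euclideanSpace_fin] at this
    omega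
  let b₁ := (stdOrthonormalBasis ℝ V).reindex (finCongr h₁)
  let b₂ := (stdOrthonormalBasis ℝ Vᗮ).reindex (finCongr h₂')
  let b : Fin n₁ ⊕ Fin n₂ → EuclideanSpace ℝ (Fin n) :=
    Sum.elim (fun j => (b₁ j : EuclideanSpace ℝ (Fin n))) fun j => b₂ j
  let Z : Matrix (Fin n) (Fin n₁ ⊕ Fin n₂) ℝ := Matrix.of fun i j => b j i
  have hin : ∀ (i : Fin n₁ ⊕ Fin n₂) (v : EuclideanSpace ℝ (Fin n)),
      (Zᵀ *ᵥ v.ofLp) i = inner ℝ (b i) v := by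
    intro i v
    simp [Matrix.mulVec, dotProduct, Z, PiLp.inner_apply, mul_comm]
  have hZZ : Zᵀ * Z = 1 := by
    ext i j
    have e : (Zᵀ * Z) i j = inner ℝ (b i) (b j) := by
      rw [← hin]; rfl
    rw [e]
    rcases i with i | i <;> rcases j with j | j
    · have := orthonormal_iff_ite.1 b₁.orthonormal i j
      simpa [b, Matrix.one_apply] using this
    · have := Submodule.inner_right_of_mem_orthogonal (b₁ i).2 (b₂ j).2
      simpa [b, Matrix.one_apply] using this
    · have := Submodule.inner_left_of_mem_orthogonal (b₁ j).2 (b₂ i).2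
      simpa [b, Matrix.one_apply] using this
    · have := orthonormal_iff_ite.1 b₂.orthonormal i j
      simpa [b, Matrix.one_apply] using this
  refine ⟨Z, hZZ, (Matrix.mul_eq_one_comm_of_card_eq _ _ _ (by simp [h₂])).1 hZZ, ?_, ?_⟩
  · intro j
    have : WithLp.toLp 2 (fun i => Z i (Sum.inl j)) = (b₁ j : EuclideanSpace ℝ (Fin n)) := by
      ext i; simp [Z, b]
    rw [this]; exact (b₁ j).2
  · intro v hv
    ext i
    have e : (Z.toCols₂ᵀ *ᵥ v.ofLp) i = (Zᵀ *ᵥ v.ofLp) (Sum.inr i) := rfl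
    rw [e, hin]
    exact Submodule.inner_left_of_mem_orthogonal hv (b₂ i).2

/-! ### Existence of the block triangular decomposition -/

section QZ
open Polynomial

theorem aeval_mul_of_intertwine {m q : Type*} [Fintype m] [DecidableEq m] [Fintype q]
    [DecidableEq q] {A : Matrix m m ℝ} {T : Matrix q q ℝ} {X : Matrix m q ℝ} (h : A * X = X * T)
    (p : ℝ[X]) : aeval A p * X = X * aeval T p := by
  have hpow : ∀ j : ℕ, A ^ j * X = X * T ^ j := by
    intro j
    induction j with
    | zero => simp
    | succ j ih => rw [pow_succ, Matrix.mul_assoc, h, ← Matrix.mul_assoc, ih, Matrix.mul_assoc,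
        ← pow_succ]
  induction p using Polynomial.induction_on' with
  | add q r hq hr => rw [map_add, map_add, Matrix.add_mul, Matrix.mul_add, hq, hr]
  | monomial j b =>
    rw [← C_mul_X_pow_eq_monomial, map_mul, map_mul, map_pow, map_pow, aeval_X, aeval_X, aeval_C,
      aeval_C, ← Algebra.smul_def, ← Algebra.smul_def, Matrix.smul_mul, Matrix.mul_smul, hpow]

/-- The kernel of a matrix as a subspace of Euclidean space. -/
def euclideanKer {n : ℕ} (B : Matrix (Fin n) (Fin n) ℝ) :
    Submodule ℝ (EuclideanSpace ℝ (Fin n)) :=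
  LinearMap.ker (B.mulVecLin ∘ₗ (WithLp.linearEquiv 2 ℝ (Fin n → ℝ)).toLinearMap)

theorem mem_euclideanKer {n : ℕ} {B : Matrix (Fin n) (Fin n) ℝ} {v : EuclideanSpace ℝ (Fin n)} :
    v ∈ euclideanKer B ↔ B *ᵥ v.ofLp = 0 := Iff.rfl

theorem rank_add_finrank_euclideanKer {n : ℕ} (B : Matrix (Fin n) (Fin n) ℝ) :
    B.rank + Module.finrank ℝ (euclideanKer B) = n := by
  have h := LinearMap.finrank_range_add_finrank_ker
    (B.mulVecLin ∘ₗ (WithLp.linearEquiv 2 ℝ (Fin n → ℝ)).toLinearMap)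
  rw [LinearMap.range_comp_of_range_eq_top _ (LinearEquiv.range _), finrank_euclideanSpace_fin] at h
  exact h

theorem toC_add_smul_mul {m : Type*} [Fintype m] (R A B : Matrix m m ℝ) (x : ℂ) :
    toC (R * A) + x • toC (R * B) = toC R * (toC A + x • toC B) := by
  rw [toC_mul, toC_mul, Matrix.mul_add, Matrix.mul_smul]

/-- The decomposition exists: with `P = Γ₀ + Γ₁` and `A = P⁻¹ Γ₀`, the eigenvalues of `A` with real
part above `1/2` belong to the zeros outside the unit circle. Orthonormal bases adapted to their
spectral subspace and to its image under `P` make both matrices block triangular. -/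
theorem exists_stableQZ {n l k : ℕ} (M : LREM n l k)
    (hdet : ∀ x : ℂ, ‖x‖ = 1 → (toC M.Γ₀ + x • toC M.Γ₁).det ≠ 0) :
    ∃ n₁ n₂ : ℕ, Nonempty (StableQZ M n₁ n₂) := by
  set P := M.Γ₀ + M.Γ₁ with hP
  have hPdet : IsUnit P.det := by
    have h := hdet 1 (by simp)
    rw [one_smul, ← Matrix.map_add _ Complex.ofReal_add, toC_det] at h
    exact isUnit_iff_ne_zero.2 (by exact_mod_cast h)
  set A := P⁻¹ * M.Γ₀ with hA
  have hPA : P * A = M.Γ₀ := by rw [hA, Matrix.mul_nonsing_inv_cancel_left _ _ hPdet]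
  have hPA' : P * (1 - A) = M.Γ₁ := by rw [Matrix.mul_sub, hPA, hP, Matrix.mul_one]; abel
  obtain ⟨p₁, p₂, hp, hp₁, hp₂⟩ :=
    Polynomial.exists_factor_re (1 / 2) A.charpoly A.charpoly_monic.ne_zero
  have hCH : aeval A p₁ * aeval A p₂ = 0 := by
    rw [← map_mul, ← hp, Matrix.aeval_self_charpoly]
  -- The spectral subspace and its image under `P`.
  set V := euclideanKer (aeval A p₁) with hV
  set U := euclideanKer (aeval A p₁ * P⁻¹) with hU
  have hrV := rank_add_finrank_euclideanKer (aeval A p₁)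
  have hrU := rank_add_finrank_euclideanKer (aeval A p₁ * P⁻¹)
  have hPinv : IsUnit P⁻¹.det := Matrix.isUnit_nonsing_inv_det _ hPdet
  rw [Matrix.rank_mul_eq_left_of_isUnit_det _ _ hPinv] at hrU
  change _ + Module.finrank ℝ U = n at hrU
  set n₁ := Module.finrank ℝ V with hn₁
  have hn₂ : n₁ + (aeval A p₁).rank = n := by omega
  have hUn : Module.finrank ℝ U = n₁ := by omega
  obtain ⟨Z, hZ1, hZ2, hZV, hZ0⟩ := exists_orthogonal_of_submodule V hn₁.symm hn₂
  obtain ⟨Y, hY1, hY2, hYU, hY0⟩ := exists_orthogonal_of_submodule U hUn hn₂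
  set T := Zᵀ * A * Z with hT
  set R := Yᵀ * P * Z with hR
  have hcomm : aeval A p₁ * A = A * aeval A p₁ := by
    have h := congrArg (aeval A) (mul_comm p₁ (X : ℝ[X]))
    rwa [map_mul, map_mul, aeval_X] at h
  have hcol : ∀ j, aeval A p₁ *ᵥ (fun i => Z i (Sum.inl j)) = 0 := fun j => hZV j
  have hT21 : T.toBlocks₂₁ = 0 := by
    ext i j
    have hm : WithLp.toLp 2 (A *ᵥ fun i => Z i (Sum.inl j)) ∈ V := by
      rw [hV, mem_euclideanKer]
      simp only
      rw [Matrix.mulVec_mulVec, hcomm, ← Matrix.mulVec_mulVec, hcol, Matrix.mulVec_zero]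
    have := congrFun (hZ0 _ hm) i
    rw [hT, Matrix.mul_assoc]
    exact this
  have hR21 : R.toBlocks₂₁ = 0 := by
    ext i j
    have hm : WithLp.toLp 2 (P *ᵥ fun i => Z i (Sum.inl j)) ∈ U := by
      rw [hU, mem_euclideanKer]
      simp only
      rw [Matrix.mulVec_mulVec, Matrix.mul_assoc, Matrix.nonsing_inv_mul _ hPdet, Matrix.mul_one,
        hcol]
    have := congrFun (hY0 _ hm) i
    rw [hR, Matrix.mul_assoc]
    exact this
  have hTb : T = Matrix.fromBlocks T.toBlocks₁₁ T.toBlocks₁₂ 0 T.toBlocks₂₂ := by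
    rw [← hT21, Matrix.fromBlocks_toBlocks]
  have hRb : R = Matrix.fromBlocks R.toBlocks₁₁ R.toBlocks₁₂ 0 R.toBlocks₂₂ := by
    rw [← hR21, Matrix.fromBlocks_toBlocks]
  have hTT : 1 - T = Matrix.fromBlocks (1 - T.toBlocks₁₁) (-T.toBlocks₁₂) 0 (1 - T.toBlocks₂₂) := by
    conv_lhs => rw [hTb, ← Matrix.fromBlocks_one]
    rw [sub_eq_add_neg, Matrix.fromBlocks_neg, Matrix.fromBlocks_add]
    simp [sub_eq_add_neg]
  -- The diagonal blocks of `T` are annihilated by the two factors.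
  have hZs : Z = Matrix.fromCols Z.toCols₁ Z.toCols₂ := (Matrix.fromCols_toCols Z).symm
  have hAZ : A * Z = Z * T := by
    rw [hT, ← Matrix.mul_assoc, ← Matrix.mul_assoc, hZ2, Matrix.one_mul]
  have hZA : Zᵀ * A = T * Zᵀ := by
    rw [hT, Matrix.mul_assoc (Zᵀ * A), hZ2, Matrix.mul_one]
  have hT1 : aeval T.toBlocks₁₁ p₁ = 0 := by
    have h1 : A * Z.toCols₁ = Z.toCols₁ * T.toBlocks₁₁ := by
      have h : (A * Z).toCols₁ = (Z * T).toCols₁ := by rw [hAZ]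
      rw [hTb, hZs, Matrix.fromCols_mul_fromBlocks, Matrix.mul_fromCols] at h
      simpa using h
    have h2 := aeval_mul_of_intertwine h1 p₁
    have h3 : aeval A p₁ * Z.toCols₁ = 0 := by
      ext i j; exact congrFun (hcol j) i
    have h4 : Z.toCols₁ᵀ * Z.toCols₁ = 1 := by
      have := congrArg Matrix.toBlocks₁₁ hZ1
      rwa [← Matrix.fromBlocks_one, Matrix.toBlocks_fromBlocks₁₁] at this
    rw [h3] at h2
    have h5 := congrArg (Z.toCols₁ᵀ * ·) h2.symm
    simpa only [← Matrix.mul_assoc, h4, Matrix.one_mul, Matrix.mul_zero] using h5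
  have hT2 : aeval T.toBlocks₂₂ p₂ = 0 := by
    have h1 : T.toBlocks₂₂ * Z.toCols₂ᵀ = Z.toCols₂ᵀ * A := by
      have h : (T * Zᵀ).toRows₂ = (Zᵀ * A).toRows₂ := by rw [hZA]
      rw [hTb, hZs, Matrix.transpose_fromCols, Matrix.fromBlocks_mul_fromRows,
        Matrix.fromRows_mul] at h
      simpa using h
    have h2 := aeval_mul_of_intertwine h1 p₂
    have h3 : Z.toCols₂ᵀ * aeval A p₂ = 0 := by
      ext i j
      have hm : WithLp.toLp 2 ((aeval A p₂) *ᵥ Pi.single j 1) ∈ V := by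
        rw [hV, mem_euclideanKer]
        simp only
        rw [Matrix.mulVec_mulVec, hCH, Matrix.zero_mulVec]
      have := congrFun (hZ0 _ hm) i
      simp only [Matrix.mulVec_single_one] at this
      exact this
    have h4 : Z.toCols₂ᵀ * Z.toCols₂ = 1 := by
      have := congrArg Matrix.toBlocks₂₂ hZ1
      rwa [← Matrix.fromBlocks_one, Matrix.toBlocks_fromBlocks₂₂] at this
    rw [h3] at h2
    have h5 := congrArg (· * Z.toCols₂) h2
    simpa only [Matrix.mul_assoc, h4, Matrix.mul_one, Matrix.zero_mul] using h5
  have e₀ : Yᵀ * M.Γ₀ * Z = R * T := by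
    rw [← hPA, hR, Matrix.mul_assoc (Yᵀ * P), ← hAZ]; simp only [Matrix.mul_assoc]
  have e₁ : Yᵀ * M.Γ₁ * Z = R * (1 - T) := by
    rw [Matrix.mul_sub, Matrix.mul_one, ← e₀, hR, hP, Matrix.mul_add, Matrix.add_mul]
    abel
  have hRdet : R.det ≠ 0 := by
    have h : R * (Zᵀ * P⁻¹ * Y) = 1 := by
      calc R * (Zᵀ * P⁻¹ * Y) = Yᵀ * P * (Z * Zᵀ) * P⁻¹ * Y := by
            rw [hR]; simp only [Matrix.mul_assoc]
        _ = 1 := by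
            rw [hZ2, Matrix.mul_one, Matrix.mul_nonsing_inv_cancel_right _ _ hPdet, hY1]
    exact (Matrix.isUnit_det_of_right_inverse h).ne_zero
  rw [hRb, Matrix.det_fromBlocks_zero₂₁] at hRdet
  have hR11 := left_ne_zero_of_mul hRdet
  have hR22 := right_ne_zero_of_mul hRdet
  have hz2 : ∀ x : ℂ, (toC (R.toBlocks₂₂ * T.toBlocks₂₂) +
      x • toC (R.toBlocks₂₂ * (1 - T.toBlocks₂₂))).det = 0 → x ≠ 1 ∧ ‖x‖ ≤ 1 := by
    intro x hx
    rw [toC_add_smul_mul, Matrix.det_mul, toC_det] at hx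
    obtain ⟨h1, h2⟩ := aeval_eq_zero_of_det_pencil hT2
      ((mul_eq_zero.1 hx).resolve_left (by exact_mod_cast hR22))
    exact ⟨h1, not_lt.1 ((re_div_sub_one_gt_half_iff h1).not.1 (not_lt.2 (hp₂ _ h2)))⟩
  have eb₀ : Yᵀ * M.Γ₀ * Z = Matrix.fromBlocks (R.toBlocks₁₁ * T.toBlocks₁₁)
      (R.toBlocks₁₁ * T.toBlocks₁₂ + R.toBlocks₁₂ * T.toBlocks₂₂) 0
      (R.toBlocks₂₂ * T.toBlocks₂₂) := by
    rw [e₀]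
    conv_lhs => rw [hTb, hRb]
    rw [Matrix.fromBlocks_multiply]
    simp
  have eb₁ : Yᵀ * M.Γ₁ * Z = Matrix.fromBlocks (R.toBlocks₁₁ * (1 - T.toBlocks₁₁))
      (R.toBlocks₁₁ * (-T.toBlocks₁₂) + R.toBlocks₁₂ * (1 - T.toBlocks₂₂)) 0
      (R.toBlocks₂₂ * (1 - T.toBlocks₂₂)) := by
    rw [e₁, hTT]
    conv_lhs => rw [hRb]
    rw [Matrix.fromBlocks_multiply]
    simp
  refine ⟨n₁, (aeval A p₁).rank, ⟨{
    Q := Yᵀ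
    Z := Z
    Λ₁₁ := _
    Λ₁₂ := _
    Λ₂₂ := _
    Ω₁₁ := _
    Ω₁₂ := _
    Ω₂₂ := _
    Q_orth := ⟨by rwa [Matrix.transpose_transpose], by rwa [Matrix.transpose_transpose]⟩
    Z_orth := ⟨hZ1, hZ2⟩
    eq_Γ₀ := eb₀
    eq_Γ₁ := eb₁
    zeros_outside := ?_
    Ω₂₂_nonsing := ?_
    zeros_inside := ?_ }⟩⟩
  · intro x hx
    rw [toC_add_smul_mul, Matrix.det_mul, toC_det] at hx
    obtain ⟨h1, h2⟩ := aeval_eq_zero_of_det_pencil hT1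
      ((mul_eq_zero.1 hx).resolve_left (by exact_mod_cast hR11))
    exact (re_div_sub_one_gt_half_iff h1).1 (hp₁ _ h2)
  · rw [Matrix.isUnit_iff_isUnit_det, Matrix.det_mul, isUnit_iff_ne_zero]
    refine mul_ne_zero hR22 fun h0 => ?_
    -- Otherwise `1` is an eigenvalue of `T₂₂`, although its real part exceeds `1/2`.
    obtain ⟨v, hv, hv0⟩ := Matrix.exists_mulVec_eq_zero_iff.2
      (show (toC (1 - T.toBlocks₂₂)).det = 0 by rw [toC_det, h0, Complex.ofReal_zero])
    have e : toC (1 - T.toBlocks₂₂) = 1 - toC T.toBlocks₂₂ := by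
      rw [← toC_one]; exact Matrix.map_sub _ Complex.ofReal_sub _ _
    rw [e, Matrix.sub_mulVec, Matrix.one_mulVec, sub_eq_zero] at hv0
    have := hp₂ 1 (aeval_eq_zero_of_eigenvector hT2 hv (a := 1) (by rw [← hv0, one_smul]))
    norm_num at this
  · intro x hx
    refine lt_of_le_of_ne (hz2 x hx).2 fun h1 => hdet x h1 ?_
    have hfull : (toC (Yᵀ * M.Γ₀ * Z) + x • toC (Yᵀ * M.Γ₁ * Z)).det = 0 := by
      have : toC (Yᵀ * M.Γ₀ * Z) + x • toC (Yᵀ * M.Γ₁ * Z) = Matrix.fromBlocks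
          (toC (R.toBlocks₁₁ * T.toBlocks₁₁) + x • toC (R.toBlocks₁₁ * (1 - T.toBlocks₁₁)))
          (toC (R.toBlocks₁₁ * T.toBlocks₁₂ + R.toBlocks₁₂ * T.toBlocks₂₂) +
            x • toC (R.toBlocks₁₁ * (-T.toBlocks₁₂) + R.toBlocks₁₂ * (1 - T.toBlocks₂₂))) 0
          (toC (R.toBlocks₂₂ * T.toBlocks₂₂) + x • toC (R.toBlocks₂₂ * (1 - T.toBlocks₂₂))) := by
        rw [eb₀, eb₁]
        simp only [toC, Matrix.fromBlocks_map, Matrix.fromBlocks_smul, Matrix.fromBlocks_add]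
        simp
      rw [this, Matrix.det_fromBlocks_zero₂₁, hx, mul_zero]
    have e : toC M.Γ₀ + x • toC M.Γ₁ =
        toC Y * (toC (Yᵀ * M.Γ₀ * Z) + x • toC (Yᵀ * M.Γ₁ * Z)) * toC Zᵀ := by
      have key : ∀ B : Matrix (Fin n) (Fin n) ℝ,
          toC Y * toC (Yᵀ * B * Z) * toC Zᵀ = toC B := by
        intro B
        rw [← toC_mul, ← toC_mul]
        congr 1
        calc Y * (Yᵀ * B * Z) * Zᵀ = (Y * Yᵀ) * B * (Z * Zᵀ) := by simp only [Matrix.mul_assoc]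
          _ = B := by rw [hY2, hZ2, Matrix.one_mul, Matrix.mul_one]
      rw [Matrix.mul_add, Matrix.add_mul, Matrix.mul_smul, Matrix.smul_mul, key, key]
    rw [e]
    -- A vector in the kernel of the transformed pencil gives one in the kernel of the original.
    obtain ⟨v, hv, hv0⟩ := Matrix.exists_mulVec_eq_zero_iff.2 hfull
    refine Matrix.exists_mulVec_eq_zero_iff.1 ⟨toC Z *ᵥ v, fun h => hv ?_, ?_⟩
    · have := congrArg (toC Zᵀ *ᵥ ·) h
      simpa only [Matrix.mulVec_mulVec, ← toC_mul, hZ1, toC_one, Matrix.one_mulVec,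
        Matrix.mulVec_zero] using this
    · rw [Matrix.mulVec_mulVec, Matrix.mul_assoc, ← toC_mul, hZ1, toC_one, Matrix.mul_one,
        ← Matrix.mulVec_mulVec, hv0, Matrix.mulVec_zero]

end QZ

/-! ### Covariance matrices and the filtration of the shocks -/

section Covariance
variable {S : Type*} [MeasurableSpace S] {μ : Measure S} {ι κ σ : Type*}

/-- All components of the random vector are square integrable. -/
def VecL2 {ι : Type*} (μ : Measure S) (X : S → ι → ℝ) : Prop := ∀ i, MemLp (fun a => X a i) 2 μ

/-- The covariance matrix of two random vectors. -/
def covMat {ι κ : Type*} (μ : Measure S) (X : S → ι → ℝ) (Y : S → κ → ℝ) : Matrix ι κ ℝ :=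
  Matrix.of fun i j => cov[fun a => X a i, fun a => Y a j; μ]

/-- The componentwise expectation of a random vector. -/
def meanVec {ι : Type*} (μ : Measure S) (X : S → ι → ℝ) : ι → ℝ := fun i => ∫ a, X a i ∂μ

theorem VecL2.mulVec [Fintype ι] {X : S → ι → ℝ} (hX : VecL2 μ X) (A : Matrix κ ι ℝ) :
    VecL2 μ fun a => A *ᵥ X a := fun i => by
  simpa only [Matrix.mulVec, dotProduct] using
    memLp_finsetSum (p := 2) Finset.univ fun j _ => (hX j).const_mul (A i j)

theorem VecL2.add {X Y : S → ι → ℝ} (hX : VecL2 μ X) (hY : VecL2 μ Y) :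
    VecL2 μ fun a => X a + Y a := fun i => (hX i).add (hY i)

theorem measurable_mulVec {S : Type*} {m : MeasurableSpace S} [Fintype ι] {X : S → ι → ℝ} (hX : Measurable X)
    (A : Matrix κ ι ℝ) : Measurable fun a => A *ᵥ X a := by
  refine measurable_pi_iff.2 fun i => ?_
  simp only [Matrix.mulVec, dotProduct]
  exact Finset.measurable_fun_sum _ fun j _ => ((measurable_pi_apply j).comp hX).const_mul _

theorem covMat_transpose (X : S → ι → ℝ) (Y : S → κ → ℝ) : (covMat μ X Y)ᵀ = covMat μ Y X := by
  ext i j; exact covariance_comm _ _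

theorem covMat_mulVec_left [IsProbabilityMeasure μ] [Fintype ι] {X : S → ι → ℝ} {Y : S → κ → ℝ} (hX : VecL2 μ X) (hY : VecL2 μ Y)
    (A : Matrix σ ι ℝ) : covMat μ (fun a => A *ᵥ X a) Y = A * covMat μ X Y := by
  ext i j
  simp only [covMat, Matrix.of_apply, Matrix.mulVec, dotProduct, Matrix.mul_apply]
  rw [covariance_fun_sum_left (fun k => (hX k).const_mul (A i k)) (hY j)]
  simp only [covariance_const_mul_left]

theorem covMat_mulVec_right [IsProbabilityMeasure μ] [Fintype κ] {X : S → ι → ℝ} {Y : S → κ → ℝ} (hX : VecL2 μ X) (hY : VecL2 μ Y)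
    (A : Matrix σ κ ℝ) : covMat μ X (fun a => A *ᵥ Y a) = covMat μ X Y * Aᵀ := by
  rw [← covMat_transpose, covMat_mulVec_left hY hX, Matrix.transpose_mul, covMat_transpose]

theorem covMat_add_left [IsProbabilityMeasure μ] {X X' : S → ι → ℝ} {Y : S → κ → ℝ} (hX : VecL2 μ X) (hX' : VecL2 μ X')
    (hY : VecL2 μ Y) : covMat μ (fun a => X a + X' a) Y = covMat μ X Y + covMat μ X' Y := by
  ext i j; exact covariance_add_left (hX i) (hX' i) (hY j)

theorem covMat_add_right [IsProbabilityMeasure μ] {X : S → ι → ℝ} {Y Y' : S → κ → ℝ} (hX : VecL2 μ X) (hY : VecL2 μ Y)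
    (hY' : VecL2 μ Y') : covMat μ X (fun a => Y a + Y' a) = covMat μ X Y + covMat μ X Y' := by
  ext i j; exact covariance_add_right (hX i) (hY j) (hY' j)

theorem covMat_congr {X X' : S → ι → ℝ} {Y Y' : S → κ → ℝ} (hX : X =ᵐ[μ] X') (hY : Y =ᵐ[μ] Y') :
    covMat μ X Y = covMat μ X' Y' := by
  ext i j
  have h1 : (fun a => X a i) =ᵐ[μ] fun a => X' a i := hX.mono fun a h => congrFun h i
  have h2 : (fun a => Y a j) =ᵐ[μ] fun a => Y' a j := hY.mono fun a h => congrFun h j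
  simp only [covMat, Matrix.of_apply, covariance]
  rw [integral_congr_ae h1, integral_congr_ae h2]
  exact integral_congr_ae (by filter_upwards [h1, h2] with a ha hb; rw [ha, hb])

theorem meanVec_mulVec [IsProbabilityMeasure μ] [Fintype ι] {X : S → ι → ℝ} (hX : VecL2 μ X) (A : Matrix κ ι ℝ) :
    meanVec μ (fun a => A *ᵥ X a) = A *ᵥ meanVec μ X := by
  ext i
  simp only [meanVec, Matrix.mulVec, dotProduct]
  rw [integral_finsetSum _ fun j _ => ((hX j).const_mul (A i j)).integrable (by norm_num)]
  simp only [integral_const_mul]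

theorem meanVec_add [IsProbabilityMeasure μ] {X Y : S → ι → ℝ} (hX : VecL2 μ X) (hY : VecL2 μ Y) :
    meanVec μ (fun a => X a + Y a) = meanVec μ X + meanVec μ Y := by
  ext i
  exact integral_add ((hX i).integrable (by norm_num)) ((hY i).integrable (by norm_num))

theorem meanVec_congr {X Y : S → ι → ℝ} (h : X =ᵐ[μ] Y) : meanVec μ X = meanVec μ Y := by
  ext i; exact integral_congr_ae (h.mono fun a ha => congrFun ha i)

theorem ae_eq_zero_of_covMat_diag [IsProbabilityMeasure μ] [Countable ι] {X : S → ι → ℝ} (hX : VecL2 μ X) (h0 : meanVec μ X = 0)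
    (hc : ∀ i, covMat μ X X i i = 0) : ∀ᵐ a ∂μ, X a = 0 := by
  have : ∀ i, ∀ᵐ a ∂μ, X a i = 0 := by
    intro i
    have hv : cov[fun a => X a i, fun a => X a i; μ] = 0 := hc i
    rw [covariance_self (hX i).aemeasurable] at hv
    have h1 := (ae_eq_integral_of_variance_eq_zero (hX i) hv)
    filter_upwards [h1] with a ha
    rw [ha]; exact congrFun h0 i
  filter_upwards [ae_all_iff.2 this] with a ha
  exact funext ha

theorem covMat_self_diag_nonneg {X : S → ι → ℝ} (hX : VecL2 μ X) (i : ι) :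
    0 ≤ covMat μ X X i i := by
  have : covMat μ X X i i = Var[fun a => X a i; μ] := covariance_self (hX i).aemeasurable
  rw [this]; exact variance_nonneg _ _

/-- Linear maps preserve covariance stationarity. -/
theorem CovStationary.map [IsProbabilityMeasure μ] [Fintype ι] [Fintype κ] {x : ℤ → S → ι → ℝ} (hx : CovStationary μ x)
    (L : (ι → ℝ) →ₗ[ℝ] (κ → ℝ)) : CovStationary μ fun t a => L (x t a) := by
  classical
  have hL : ∀ v, L v = LinearMap.toMatrix' L *ᵥ v := fun v => by
    rw [LinearMap.toMatrix'_mulVec]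
  simp only [hL]
  generalize LinearMap.toMatrix' L = A
  have h2 : ∀ t, VecL2 μ (x t) := hx.memLp
  refine ⟨fun t => (h2 t).mulVec A, fun s t i => ?_, fun s t h i j => ?_⟩
  · have e : meanVec μ (x s) = meanVec μ (x t) := funext (hx.mean s t)
    have := congrFun (congrArg (A *ᵥ ·) e) i
    simp only [← meanVec_mulVec (h2 _)] at this
    exact this
  · have e : covMat μ (x (s + h)) (x (t + h)) = covMat μ (x s) (x t) := by
      ext i j; exact hx.cov s t h i j
    have := congrArg (fun B => (A * (B * Aᵀ)) i j) e
    simp only [← covMat_mulVec_right (h2 _) (h2 _),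
      ← covMat_mulVec_left (h2 _) ((h2 _).mulVec A)] at this
    exact this

/-- A square integrable variable with vanishing conditional expectation has mean zero and is
uncorrelated with everything in the conditioning information. -/
theorem covariance_eq_zero_of_condExp {S : Type*} {m m₀ : MeasurableSpace S}
    {μ : Measure[m₀] S} [IsProbabilityMeasure μ] (hm : m ≤ m₀) {X U : S → ℝ}
    (hX : Measurable[m] X) (hX2 : MemLp X 2 μ) (hU : MemLp U 2 μ) (h : μ[U | m] =ᵐ[μ] 0) :
    cov[X, U; μ] = 0 ∧ ∫ a, U a ∂μ = 0 := by
  have hU0 : ∫ a, U a ∂μ = 0 := by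
    rw [← integral_condExp hm, integral_congr_ae h]; simp
  refine ⟨?_, hU0⟩
  rw [covariance_eq_sub hX2 hU, hU0, mul_zero, sub_zero, ← integral_condExp hm]
  have := condExp_mul_of_stronglyMeasurable_left (μ := μ) hX.stronglyMeasurable
    (hX2.integrable_mul hU) (hU.integrable (by norm_num))
  rw [integral_congr_ae this]
  have h3 : X * μ[U | m] =ᵐ[μ] 0 := by
    filter_upwards [h] with a ha
    simp [ha]
  rw [integral_congr_ae h3]; simp

end Covariance

theorem past_mono {S : Type*} {l : ℕ} (z : ℤ → S → Fin l → ℝ) {s t : ℤ} (h : s ≤ t) : past z s ≤ past z t :=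
  iSup₂_le fun r hr => le_iSup₂ (f := fun (s : ℤ) (_ : s ≤ t) =>
    MeasurableSpace.comap (z s) inferInstance) r (hr.trans h)

theorem measurable_past {S : Type*} {l : ℕ} (z : ℤ → S → Fin l → ℝ) {s t : ℤ} (h : s ≤ t) :
    Measurable[past z t] (z s) :=
  (comap_measurable (z s)).mono (le_iSup₂ (f := fun (s : ℤ) (_ : s ≤ t) =>
    MeasurableSpace.comap (z s) inferInstance) s h) le_rfl

section Shocks
variable {S : Type*} [MeasurableSpace S] {μ : Measure S} {l : ℕ} {z : ℤ → S → Fin l → ℝ}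

theorem IsShock.past_le (hz : IsShock μ z) (t : ℤ) : past z t ≤ ‹MeasurableSpace S› :=
  iSup₂_le fun s _ => (hz.measurable s).comap_le

theorem IsShock.indep_past (hz : IsShock μ z) (t : ℤ) :
    Indep (MeasurableSpace.comap (z (t + 1)) inferInstance) (past z t) μ := by
  have h := indep_iSup_of_disjoint (fun s => (hz.measurable s).comap_le) hz.indep
    (S := {t + 1}) (T := Set.Iic t) (by simp)
  simpa using h

theorem IsShock.condExp_eq_zero [IsProbabilityMeasure μ] (hz : IsShock μ z) (t : ℤ) (i : Fin l) :
    μ[fun a => z (t + 1) a i | past z t] =ᵐ[μ] 0 := by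
  have h := condExp_indep_eq (hz.measurable (t + 1)).comap_le (hz.past_le t)
    (f := fun a => z (t + 1) a i)
    (((measurable_pi_apply i).comp (comap_measurable (z (t + 1)))).stronglyMeasurable)
    (hz.indep_past t)
  refine h.trans ?_
  rw [hz.mean_zero]; rfl

end Shocks

/-! ### The model in the coordinates of the decomposition -/

section QZAlgebra
variable {n l k n₁ n₂ r : ℕ} {M : LREM n l k} (D : StableQZ M n₁ n₂)

namespace StableQZ

/-- The columns of `Z` that span the stable deflating subspace. -/
abbrev Z₁ : Matrix (Fin n) (Fin n₁) ℝ := D.Z.toCols₁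

/-- The remaining columns of `Z`; `Z₂ᵀ y` is the explosive part of `y`. -/
abbrev Z₂ : Matrix (Fin n) (Fin n₂) ℝ := D.Z.toCols₂

/-- The matrix by which a disturbance `g` of the model enters the stable solution of
`Γ₀ y(t) = Γ₁ y(t-1) + g(t)`. -/
def impact : Matrix (Fin n) (Fin n) ℝ :=
  D.Z * Matrix.fromRows (D.Λ₁₁⁻¹ * D.Q₁) (0 : Matrix (Fin n₂) (Fin n) ℝ)

theorem Z_eq : D.Z = Matrix.fromCols D.Z₁ D.Z₂ := (Matrix.fromCols_toCols D.Z).symm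

theorem Q_eq : D.Q = Matrix.fromRows D.Q₁ D.Q₂ := (Matrix.fromRows_toRows D.Q).symm

theorem Z_blocks : Matrix.fromBlocks (D.Z₁ᵀ * D.Z₁) (D.Z₁ᵀ * D.Z₂) (D.Z₂ᵀ * D.Z₁) (D.Z₂ᵀ * D.Z₂) =
    Matrix.fromBlocks 1 0 0 1 := by
  have h := D.Z_orth.1
  rw [D.Z_eq, Matrix.transpose_fromCols, Matrix.fromRows_mul_fromCols] at h
  rw [h, Matrix.fromBlocks_one]

theorem Z₁_Z₁ : D.Z₁ᵀ * D.Z₁ = 1 := (Matrix.fromBlocks_inj.1 D.Z_blocks).1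

theorem Z₂_Z₁ : D.Z₂ᵀ * D.Z₁ = 0 := (Matrix.fromBlocks_inj.1 D.Z_blocks).2.2.1

theorem Z_sum : D.Z₁ * D.Z₁ᵀ + D.Z₂ * D.Z₂ᵀ = 1 := by
  have h := D.Z_orth.2
  rwa [D.Z_eq, Matrix.transpose_fromCols, Matrix.fromCols_mul_fromRows] at h

theorem impact_eq : D.impact = D.Z₁ * (D.Λ₁₁⁻¹ * D.Q₁) := by
  rw [impact, D.Z_eq, Matrix.fromCols_mul_fromRows, Matrix.mul_zero, add_zero]

theorem Θ₁_eq : D.Θ₁ = D.Z₁ * (D.Λ₁₁⁻¹ * D.Ω₁₁) * D.Z₁ᵀ := by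
  rw [Θ₁, D.Z_eq, Matrix.fromCols_mul_fromBlocks, Matrix.transpose_fromCols,
    Matrix.fromCols_mul_fromRows]
  simp

theorem Z₂_Θ₁ : D.Z₂ᵀ * D.Θ₁ = 0 := by
  rw [D.Θ₁_eq, ← Matrix.mul_assoc, ← Matrix.mul_assoc, D.Z₂_Z₁, Matrix.zero_mul, Matrix.zero_mul]

theorem Z₂_impact : D.Z₂ᵀ * D.impact = 0 := by
  rw [D.impact_eq, ← Matrix.mul_assoc, D.Z₂_Z₁, Matrix.zero_mul]

theorem isUnit_det_Λ₁₁ : IsUnit D.Λ₁₁.det := by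
  rw [isUnit_iff_ne_zero]
  intro h
  have := D.zeros_outside 0 (by rw [zero_smul, add_zero, toC_det, h, Complex.ofReal_zero])
  norm_num at this

theorem isUnit_det_Ω₂₂ : IsUnit D.Ω₂₂.det := (Matrix.isUnit_iff_isUnit_det _).1 D.Ω₂₂_nonsing

theorem isStable_Θ₁ : IsSchurStable D.Θ₁ := by
  intro c hc
  by_cases hc0 : c = 0
  · rw [hc0]; simp
  obtain ⟨v, hv, hv0⟩ := Matrix.exists_mulVec_eq_zero_iff.2 hc
  rw [Matrix.sub_mulVec, Matrix.smul_mulVec, Matrix.one_mulVec, sub_eq_zero] at hv0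
  have h1 : D.Λ₁₁ * D.Z₁ᵀ * D.Θ₁ = D.Ω₁₁ * D.Z₁ᵀ := by
    rw [D.Θ₁_eq]
    calc D.Λ₁₁ * D.Z₁ᵀ * (D.Z₁ * (D.Λ₁₁⁻¹ * D.Ω₁₁) * D.Z₁ᵀ)
        = D.Λ₁₁ * ((D.Z₁ᵀ * D.Z₁) * (D.Λ₁₁⁻¹ * D.Ω₁₁)) * D.Z₁ᵀ := by simp only [Matrix.mul_assoc]
      _ = _ := by
        rw [D.Z₁_Z₁, Matrix.one_mul, Matrix.mul_nonsing_inv_cancel_left _ _ D.isUnit_det_Λ₁₁]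
  -- `u = Z₁ᵀ v` is an eigenvector of the pencil of the first block.
  have h2 : toC D.Ω₁₁ *ᵥ (toC D.Z₁ᵀ *ᵥ v) = c • (toC D.Λ₁₁ *ᵥ (toC D.Z₁ᵀ *ᵥ v)) := by
    rw [Matrix.mulVec_mulVec, ← toC_mul, ← h1, toC_mul, toC_mul, ← Matrix.mulVec_mulVec, ← hv0,
      Matrix.mulVec_smul, Matrix.mulVec_mulVec]
  have hu : toC D.Z₁ᵀ *ᵥ v ≠ 0 := by
    intro h
    have : c • v = 0 := by
      rw [hv0, D.Θ₁_eq, toC_mul, ← Matrix.mulVec_mulVec, h, Matrix.mulVec_zero]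
    exact hv ((smul_eq_zero.1 this).resolve_left hc0)
  have h3 : (toC D.Λ₁₁ + (-c⁻¹) • toC D.Ω₁₁).det = 0 := by
    refine Matrix.exists_mulVec_eq_zero_iff.1 ⟨_, hu, ?_⟩
    rw [Matrix.add_mulVec, Matrix.smul_mulVec, h2, smul_smul, neg_mul, inv_mul_cancel₀ hc0,
      neg_one_smul, add_neg_cancel]
  have h4 := D.zeros_outside _ h3
  rw [norm_neg, norm_inv] at h4
  exact (one_lt_inv₀ (norm_pos_iff.2 hc0)).1 h4

/-- The matrix of the second block, solved forward, is stable. -/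
theorem isStable_forward : IsSchurStable (D.Ω₂₂⁻¹ * D.Λ₂₂) := by
  intro c hc
  obtain ⟨v, hv, hv0⟩ := Matrix.exists_mulVec_eq_zero_iff.2 hc
  rw [Matrix.sub_mulVec, Matrix.smul_mulVec, Matrix.one_mulVec, sub_eq_zero] at hv0
  have h2 : toC D.Λ₂₂ *ᵥ v = c • (toC D.Ω₂₂ *ᵥ v) := by
    rw [← Matrix.mulVec_smul, hv0, Matrix.mulVec_mulVec, ← toC_mul,
      Matrix.mul_nonsing_inv_cancel_left _ _ D.isUnit_det_Ω₂₂]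
  have := D.zeros_inside (-c) (Matrix.exists_mulVec_eq_zero_iff.1 ⟨v, hv, by
    rw [Matrix.add_mulVec, Matrix.smul_mulVec, h2, neg_smul, add_neg_cancel]⟩)
  rwa [norm_neg] at this

/-- The model equation in the coordinates of the decomposition. -/
theorem equation_iff_blocks (y y' g : Fin n → ℝ) :
    M.Γ₀ *ᵥ y = M.Γ₁ *ᵥ y' + g ↔
      D.Λ₁₁ *ᵥ (D.Z₁ᵀ *ᵥ y) + D.Λ₁₂ *ᵥ (D.Z₂ᵀ *ᵥ y) =
        D.Ω₁₁ *ᵥ (D.Z₁ᵀ *ᵥ y') + D.Ω₁₂ *ᵥ (D.Z₂ᵀ *ᵥ y') + D.Q₁ *ᵥ g ∧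
      D.Λ₂₂ *ᵥ (D.Z₂ᵀ *ᵥ y) = D.Ω₂₂ *ᵥ (D.Z₂ᵀ *ᵥ y') + D.Q₂ *ᵥ g := by
  have hZ : ∀ v : Fin n → ℝ, D.Zᵀ *ᵥ v = Sum.elim (D.Z₁ᵀ *ᵥ v) (D.Z₂ᵀ *ᵥ v) := by
    intro v
    conv_lhs => rw [D.Z_eq]
    rw [Matrix.transpose_fromCols, Matrix.fromRows_mulVec]
  have h0 : ∀ (B : Matrix (Fin n) (Fin n) ℝ) (v : Fin n → ℝ),
      D.Q *ᵥ (B *ᵥ v) = (D.Q * B * D.Z) *ᵥ (D.Zᵀ *ᵥ v) := by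
    intro B v
    rw [Matrix.mulVec_mulVec, Matrix.mulVec_mulVec, Matrix.mul_assoc _ D.Z, D.Z_orth.2,
      Matrix.mul_one]
  have hinj : Function.Injective (D.Q *ᵥ ·) := by
    intro a b hab
    have := congrArg (D.Qᵀ *ᵥ ·) hab
    simpa only [Matrix.mulVec_mulVec, D.Q_orth.1, Matrix.one_mulVec] using this
  have hQ : D.Q *ᵥ g = Sum.elim (D.Q₁ *ᵥ g) (D.Q₂ *ᵥ g) := by
    conv_lhs => rw [D.Q_eq]
    rw [Matrix.fromRows_mulVec]
  rw [← hinj.eq_iff]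
  simp only [Matrix.mulVec_add]
  rw [h0, h0, D.eq_Γ₀, D.eq_Γ₁, hZ, hZ, hQ, Matrix.fromBlocks_mulVec, Matrix.fromBlocks_mulVec]
  simp only [Sum.elim_comp_inl, Sum.elim_comp_inr, Matrix.zero_mulVec, zero_add]
  rw [← Sum.elim_add_add, Sum.elim_eq_iff]

/-- On the stable subspace the model equation is a vector autoregression together with a
restriction on the disturbance. -/
theorem equation_iff {y y' : Fin n → ℝ} (hy : D.Z₂ᵀ *ᵥ y = 0) (hy' : D.Z₂ᵀ *ᵥ y' = 0)
    (g : Fin n → ℝ) : M.Γ₀ *ᵥ y = M.Γ₁ *ᵥ y' + g ↔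
      D.Q₂ *ᵥ g = 0 ∧ y = D.Θ₁ *ᵥ y' + D.impact *ᵥ g := by
  rw [D.equation_iff_blocks, hy, hy']
  simp only [Matrix.mulVec_zero, add_zero, zero_add]
  rw [and_comm, eq_comm (a := (0 : Fin n₂ → ℝ))]
  refine and_congr_right fun _ => ?_
  have hyZ : D.Z₁ *ᵥ (D.Z₁ᵀ *ᵥ y) = y := by
    have := congrArg (· *ᵥ y) D.Z_sum
    simp only [Matrix.add_mulVec, ← Matrix.mulVec_mulVec, hy, Matrix.mulVec_zero, add_zero,
      Matrix.one_mulVec] at this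
    exact this
  have hrhs : D.Θ₁ *ᵥ y' + D.impact *ᵥ g =
      D.Z₁ *ᵥ (D.Λ₁₁⁻¹ *ᵥ (D.Ω₁₁ *ᵥ (D.Z₁ᵀ *ᵥ y') + D.Q₁ *ᵥ g)) := by
    rw [D.Θ₁_eq, D.impact_eq]
    simp only [Matrix.mulVec_add, Matrix.mulVec_mulVec, Matrix.mul_assoc]
  rw [hrhs]
  constructor
  · intro h
    rw [← h, Matrix.mulVec_mulVec _ D.Λ₁₁⁻¹, Matrix.nonsing_inv_mul _ D.isUnit_det_Λ₁₁,
      Matrix.one_mulVec, hyZ]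
  · intro h
    have := congrArg (fun v => D.Λ₁₁ *ᵥ (D.Z₁ᵀ *ᵥ v)) h
    beta_reduce at this
    rw [this, Matrix.mulVec_mulVec _ D.Z₁ᵀ, D.Z₁_Z₁, Matrix.one_mulVec, Matrix.mulVec_mulVec,
      Matrix.mul_nonsing_inv _ D.isUnit_det_Λ₁₁, Matrix.one_mulVec]

theorem Θz_eq : D.Θz = D.impact * (M.Ψ + M.Pi * D.Hstd) := by
  rw [D.impact_eq, Θz, D.Z_eq, Matrix.fromCols_mul_fromRows, Matrix.mul_zero, add_zero, Hstd]
  simp only [Matrix.mul_add, Matrix.mul_neg, Matrix.mul_assoc, sub_eq_add_neg]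

theorem Θν_eq (K : Matrix (Fin k) (Fin r) ℝ) : D.Θν K = D.impact * M.Pi * K := by
  rw [D.impact_eq, Θν, D.Z_eq, Matrix.fromCols_mul_fromRows, Matrix.mul_zero, add_zero]
  simp only [Matrix.mul_assoc]

end StableQZ

theorem one_sub_mul_pinv_mul {m n : ℕ} (A : Matrix (Fin m) (Fin n) ℝ) :
    (1 - A * pinv A) * A = 0 := by
  rw [Matrix.sub_mul, (pinv_penrose A).1, Matrix.one_mul, sub_self]

theorem matIm_le_iff {m n q : ℕ} (A : Matrix (Fin m) (Fin n) ℝ) (B : Matrix (Fin m) (Fin q) ℝ) :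
    matIm B ≤ matIm A ↔ (1 - A * pinv A) * B = 0 := by
  constructor
  · intro h
    ext i j
    obtain ⟨v, hv⟩ := h ⟨Pi.single j 1, rfl⟩
    have h1 : B *ᵥ Pi.single j 1 = A *ᵥ v := hv.symm
    have h2 := congrArg ((1 - A * pinv A) *ᵥ ·) h1
    simp only [Matrix.mulVec_mulVec, one_sub_mul_pinv_mul, Matrix.zero_mulVec] at h2
    have := congrFun h2 i
    rwa [Matrix.mulVec_single_one] at this
  · rintro h _ ⟨v, rfl⟩
    rw [Matrix.sub_mul, Matrix.one_mul, sub_eq_zero] at h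
    refine ⟨(pinv A * B) *ᵥ v, ?_⟩
    simp only [Matrix.mulVecLin_apply]
    rw [Matrix.mulVec_mulVec, ← Matrix.mul_assoc, ← h]

theorem StableQZ.existenceCondition_iff :
    D.ExistenceCondition ↔ D.Q₂ * (M.Ψ + M.Pi * D.Hstd) = 0 := by
  rw [ExistenceCondition, matIm_le_iff, Hstd]
  have : D.Q₂ * (M.Ψ + M.Pi * -(pinv (D.Q₂ * M.Pi) * (D.Q₂ * M.Ψ))) =
      (1 - D.Q₂ * M.Pi * pinv (D.Q₂ * M.Pi)) * (D.Q₂ * M.Ψ) := by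
    rw [Matrix.sub_mul]
    simp only [Matrix.mul_add, Matrix.one_mul, Matrix.mul_neg, Matrix.mul_assoc, sub_eq_add_neg]
  rw [this]

theorem pinv_mul_self_eq_one {K : Matrix (Fin k) (Fin r) ℝ}
    (h : LinearIndependent ℝ fun j => K.col j) : pinv K * K = 1 := by
  have hinj := Matrix.mulVec_injective_iff.2 h
  have h0 : K * (pinv K * K) = K * (1 : Matrix (Fin r) (Fin r) ℝ) := by
    rw [← Matrix.mul_assoc, (pinv_penrose K).1, Matrix.mul_one]
  ext i j
  have : K *ᵥ (pinv K * K).col j = K *ᵥ (1 : Matrix (Fin r) (Fin r) ℝ).col j := by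
    have := congrArg (fun B => B.col j) h0
    exact this
  exact congrFun (hinj this) i

/-- `K†` recovers the coordinates of a vector of the kernel in the basis `K`. -/
theorem IsKerBasis.mul_pinv_mulVec {m : ℕ} {A : Matrix (Fin m) (Fin k) ℝ}
    {K : Matrix (Fin k) (Fin r) ℝ} (hK : IsKerBasis A K) {v : Fin k → ℝ} (hv : A *ᵥ v = 0) :
    K *ᵥ (pinv K *ᵥ v) = v := by
  have hmem : v ∈ matKer A := hv
  rw [← hK.2, ← Matrix.range_mulVecLin] at hmem
  obtain ⟨c, rfl⟩ := hmem
  simp only [Matrix.mulVecLin_apply]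
  rw [Matrix.mulVec_mulVec c, pinv_mul_self_eq_one hK.1, Matrix.one_mulVec]

theorem IsKerBasis.mul_eq_zero {m : ℕ} {A : Matrix (Fin m) (Fin k) ℝ}
    {K : Matrix (Fin k) (Fin r) ℝ} (hK : IsKerBasis A K) : A * K = 0 := by
  ext i j
  have : K.col j ∈ matKer A := by
    rw [← hK.2]; exact Submodule.subset_span ⟨j, rfl⟩
  exact congrFun (show A *ᵥ K.col j = 0 from this) i

end QZAlgebra

/-! ### Innovations, and uniqueness of stationary processes -/

section Innovations
variable {S : Type*} [MeasurableSpace S] {μ : Measure S} {l : ℕ} {z : ℤ → S → Fin l → ℝ}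
  {ι κ : Type*}

/-- A square integrable process with mean zero whose value at each date is uncorrelated with
everything known earlier. -/
structure IsInnovation {ι : Type*} (μ : Measure S) (z : ℤ → S → Fin l → ℝ) (u : ℤ → S → ι → ℝ) :
    Prop where
  memLp : ∀ t, VecL2 μ (u t)
  mean : ∀ t, meanVec μ (u t) = 0
  orth : ∀ s t, s < t → ∀ X : S → ℝ, Measurable[past z s] X → MemLp X 2 μ → ∀ i,
    cov[X, fun a => u t a i; μ] = 0

theorem IsInnovation.covMat_eq_zero {u : ℤ → S → ι → ℝ} (hu : IsInnovation μ z u) {s t : ℤ}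
    (hst : s < t) {X : S → κ → ℝ} (hX : Measurable[past z s] X) (hX2 : VecL2 μ X) :
    covMat μ X (u t) = 0 := by
  ext i j
  exact hu.orth s t hst _ ((measurable_pi_apply i).comp hX) (hX2 i) j

theorem IsInnovation.of_scalar [IsProbabilityMeasure μ] {u : ℤ → S → ι → ℝ}
    (h2 : ∀ t, VecL2 μ (u t)) (hm : ∀ t, past z t ≤ ‹MeasurableSpace S›)
    (h : ∀ t i, μ[fun a => u (t + 1) a i | past z t] =ᵐ[μ] 0) : IsInnovation μ z u := by
  have key : ∀ s t, s < t → ∀ X : S → ℝ, Measurable[past z s] X → MemLp X 2 μ → ∀ i,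
      cov[X, fun a => u t a i; μ] = 0 ∧ ∫ a, u t a i ∂μ = 0 := by
    intro s t hst X hX hX2 i
    have := h (t - 1) i
    rw [sub_add_cancel] at this
    exact covariance_eq_zero_of_condExp (hm (t - 1))
      (hX.mono (past_mono z (by omega)) le_rfl) hX2 (h2 t i) this
  refine ⟨h2, fun t => funext fun i => ?_, fun s t hst X hX hX2 i => (key s t hst X hX hX2 i).1⟩
  exact (key (t - 1) t (by omega) (fun _ => 0) measurable_const (memLp_const 0) i).2

theorem IsInnovation.mulVec [IsProbabilityMeasure μ] [Fintype ι] {u : ℤ → S → ι → ℝ}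
    (hu : IsInnovation μ z u) (A : Matrix κ ι ℝ) : IsInnovation μ z fun t a => A *ᵥ u t a := by
  refine ⟨fun t => (hu.memLp t).mulVec A, fun t => ?_, fun s t hst X hX hX2 i => ?_⟩
  · rw [meanVec_mulVec (hu.memLp t), hu.mean, Matrix.mulVec_zero]
  · simp only [Matrix.mulVec, dotProduct]
    rw [covariance_fun_sum_right (fun j => (hu.memLp t j).const_mul (A i j)) hX2]
    simp only [covariance_const_mul_right, hu.orth s t hst X hX hX2, mul_zero, Finset.sum_const_zero]

theorem IsInnovation.add [IsProbabilityMeasure μ] {u v : ℤ → S → ι → ℝ}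
    (hu : IsInnovation μ z u) (hv : IsInnovation μ z v) :
    IsInnovation μ z fun t a => u t a + v t a := by
  refine ⟨fun t => (hu.memLp t).add (hv.memLp t), fun t => ?_, fun s t hst X hX hX2 i => ?_⟩
  · rw [meanVec_add (hu.memLp t) (hv.memLp t), hu.mean, hv.mean, add_zero]
  · have := covariance_add_right hX2 (hu.memLp t i) (hv.memLp t i)
    rw [hu.orth s t hst X hX hX2, hv.orth s t hst X hX hX2, add_zero] at this
    exact this

theorem IsShock.isInnovation [IsProbabilityMeasure μ] (hz : IsShock μ z) : IsInnovation μ z z :=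
  .of_scalar hz.memLp hz.past_le hz.condExp_eq_zero

theorem abs_covariance_le [IsProbabilityMeasure μ] {X Y : S → ℝ} (hX : MemLp X 2 μ)
    (hY : MemLp Y 2 μ) : |cov[X, Y; μ]| ≤ (cov[X, X; μ] + cov[Y, Y; μ]) / 2 := by
  have h1 : 0 ≤ cov[X + Y, X + Y; μ] := by
    rw [covariance_self (hX.add hY).aemeasurable]; exact variance_nonneg _ _
  have h2 : 0 ≤ cov[X - Y, X - Y; μ] := by
    rw [covariance_self (hX.sub hY).aemeasurable]; exact variance_nonneg _ _
  rw [covariance_add_left hX hY (hX.add hY), covariance_add_right hX hX hY,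
    covariance_add_right hY hX hY, covariance_comm Y X] at h1
  rw [covariance_sub_left hX hY (hX.sub hY), covariance_sub_right hX hX hY,
    covariance_sub_right hY hX hY, covariance_comm Y X] at h2
  rw [abs_le]
  constructor <;> linarith

/-- A stationary process that is a stable function of its own future up to an innovation has to
vanish: its covariance with itself is dampened by arbitrarily high powers of a stable matrix. -/
theorem ae_eq_zero_of_forward [IsProbabilityMeasure μ] [Fintype ι] [DecidableEq ι]
    {F : Matrix ι ι ℝ} (hF : IsSchurStable F) {w ξ : ℤ → S → ι → ℝ} (hw : CovStationary μ w)
    (hwm : ∀ t, Measurable[past z t] (w t)) (hξ : IsInnovation μ z ξ)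
    (heq : ∀ t, ∀ᵐ a ∂μ, w t a = F *ᵥ w (t + 1) a + ξ (t + 1) a) (t : ℤ) :
    ∀ᵐ a ∂μ, w t a = 0 := by
  have h2 : ∀ t, VecL2 μ (w t) := hw.memLp
  refine ae_eq_zero_of_covMat_diag (h2 t) ?_ fun i => ?_
  · have h1 : meanVec μ (w t) = F *ᵥ meanVec μ (w t) := by
      have e : meanVec μ (w (t + 1)) = meanVec μ (w t) := funext (hw.mean _ _)
      conv_lhs => rw [meanVec_congr (heq t), meanVec_add ((h2 _).mulVec F) (hξ.memLp _),
        meanVec_mulVec (h2 _), hξ.mean, add_zero, e]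
    have h3 : (1 - F) *ᵥ meanVec μ (w t) = 0 := by
      rw [Matrix.sub_mulVec, Matrix.one_mulVec, ← h1, sub_self]
    exact (Matrix.mulVec_injective_iff_isUnit.2 hF.isUnit_one_sub) (by rw [h3, Matrix.mulVec_zero])
  · have hstep : ∀ j : ℕ, covMat μ (w t) (w t) = covMat μ (w t) (w (t + j)) * (F ^ j)ᵀ := by
      intro j
      induction j with
      | zero => simp
      | succ j ih =>
        rw [ih, covMat_congr (X := w t) (Filter.EventuallyEq.refl _ _) (heq (t + j)),
          covMat_add_right (h2 t) ((h2 _).mulVec F) (hξ.memLp _),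
          hξ.covMat_eq_zero (by omega) (hwm t) (h2 t), add_zero,
          covMat_mulVec_right (h2 t) (h2 _), Matrix.mul_assoc, ← Matrix.transpose_mul, ← pow_succ]
        push_cast
        rw [add_assoc]
    have hdiag : ∀ s i, covMat μ (w s) (w s) i i = covMat μ (w t) (w t) i i := by
      intro s i
      have := hw.cov t t (s - t) i i
      rwa [add_sub_cancel] at this
    have hb : ∀ (j : ℕ) k, |covMat μ (w t) (w (t + j)) i k| ≤
        (covMat μ (w t) (w t) i i + covMat μ (w t) (w t) k k) / 2 := by
      intro j k
      rw [← hdiag (t + j) k]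
      exact abs_covariance_le (h2 t i) (h2 (t + j) k)
    have hlim : Filter.Tendsto (fun j : ℕ => (covMat μ (w t) (w (t + j)) * (F ^ j)ᵀ) i i)
        Filter.atTop (nhds 0) := by
      simp only [Matrix.mul_apply, Matrix.transpose_apply]
      have : (0 : ℝ) = ∑ k : ι, 0 := by simp
      rw [this]
      refine tendsto_finsetSum _ fun k _ => ?_
      refine Filter.Tendsto.zero_mul_isBoundedUnder_le (hF.tendsto_pow i k)
        (g := fun j : ℕ => covMat μ (w t) (w (t + j)) i k) ?_ |>.congr fun j => mul_comm _ _
      exact Filter.isBoundedUnder_of ⟨_, fun j => hb j k⟩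
    simp only [← hstep] at hlim
    exact tendsto_nhds_unique tendsto_const_nhds hlim

/-- Two processes with bounded second moments that obey the same stable autoregression differ by
a process that vanishes. -/
theorem ae_eq_of_autoregression [IsProbabilityMeasure μ] [Fintype ι] [DecidableEq ι]
    {A : Matrix ι ι ℝ} (hA : IsSchurStable A) {y y' v : ℤ → S → ι → ℝ} (hy : CovStationary μ y)
    (hy' : CovStationary μ y') (h : ∀ t, ∀ᵐ a ∂μ, y t a = A *ᵥ y (t - 1) a + v t a)
    (h' : ∀ t, ∀ᵐ a ∂μ, y' t a = A *ᵥ y' (t - 1) a + v t a) (t : ℤ) : y t =ᵐ[μ] y' t := by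
  have habs : ∀ x : ℤ → S → ι → ℝ, CovStationary μ x → ∀ t i,
      ∫ a, |x t a i| ∂μ ≤ 1 + (cov[fun a => x 0 a i, fun a => x 0 a i; μ] +
        (∫ a, x 0 a i ∂μ) * ∫ a, x 0 a i ∂μ) := by
    intro x hx t i
    have e1 := hx.cov 0 0 t i i
    rw [zero_add] at e1
    have e2 := covariance_eq_sub (hx.memLp t i) (hx.memLp t i)
    rw [e1, hx.mean t 0 i] at e2
    rw [e2, sub_add_cancel]
    have hi : Integrable (fun a => x t a i * x t a i) μ := (hx.memLp t i).integrable_mul (hx.memLp t i)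
    calc ∫ a, |x t a i| ∂μ ≤ ∫ a, (1 + x t a i * x t a i) ∂μ := by
          refine integral_mono ((hx.memLp t i).integrable (by norm_num)).abs
            ((integrable_const 1).add hi) fun a => ?_
          change |x t a i| ≤ 1 + x t a i * x t a i
          nlinarith [sq_nonneg (|x t a i| - 1), abs_mul_abs_self (x t a i), abs_nonneg (x t a i)]
      _ = _ := by rw [integral_add (integrable_const 1) hi]; simp
  have hpow : ∀ j : ℕ, ∀ᵐ a ∂μ, y t a - y' t a = (A ^ j) *ᵥ (y (t - j) a - y' (t - j) a) := by
    intro j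
    induction j with
    | zero => simp
    | succ j ih =>
      filter_upwards [ih, h (t - j), h' (t - j)] with a h1 h2 h3
      rw [h1, h2, h3, add_sub_add_right_eq_sub, ← Matrix.mulVec_sub, Matrix.mulVec_mulVec,
        ← pow_succ]
      push_cast
      rw [sub_sub]
  have hL1 : ∀ s i, Integrable (fun a => |y s a i - y' s a i|) μ := fun s i =>
    (((hy.memLp s i).sub (hy'.memLp s i)).integrable (by norm_num)).abs
  obtain ⟨C, hC⟩ : ∃ C : ι → ℝ, ∀ s i, ∫ a, |y s a i - y' s a i| ∂μ ≤ C i := by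
    refine ⟨fun i => _, fun s i => le_trans ?_ (add_le_add (habs y hy s i) (habs y' hy' s i))⟩
    have i1 := ((hy.memLp s i).integrable (by norm_num)).abs
    have i2 := ((hy'.memLp s i).integrable (by norm_num)).abs
    rw [← integral_add i1 i2]
    exact integral_mono (hL1 s i) (i1.add i2) fun a => abs_sub _ _
  have hzero : ∀ i, ∫ a, |y t a i - y' t a i| ∂μ = 0 := by
    intro i
    have hle : ∀ j : ℕ, ∫ a, |y t a i - y' t a i| ∂μ ≤ ∑ k, |(A ^ j) i k| * C k := by
      intro j
      calc ∫ a, |y t a i - y' t a i| ∂μ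
          ≤ ∫ a, ∑ k, |(A ^ j) i k| * |y (t - j) a k - y' (t - j) a k| ∂μ := by
            refine integral_mono_ae (hL1 t i)
              (integrable_finsetSum _ fun k _ => (hL1 _ k).const_mul _) ?_
            filter_upwards [hpow j] with a ha
            have := congrFun ha i
            simp only [Pi.sub_apply, Matrix.mulVec, dotProduct] at this
            rw [this]
            refine (Finset.abs_sum_le_sum_abs _ _).trans (le_of_eq ?_)
            simp only [abs_mul]
        _ = ∑ k, |(A ^ j) i k| * ∫ a, |y (t - j) a k - y' (t - j) a k| ∂μ := by
            rw [integral_finsetSum _ fun k _ => (hL1 _ k).const_mul _]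
            simp only [integral_const_mul]
        _ ≤ _ := Finset.sum_le_sum fun k _ => mul_le_mul_of_nonneg_left (hC _ k) (abs_nonneg _)
    have hlim : Filter.Tendsto (fun j : ℕ => ∑ k, |(A ^ j) i k| * C k) Filter.atTop (nhds 0) := by
      have : (0 : ℝ) = ∑ k : ι, |0| * C k := by simp
      rw [this]
      exact tendsto_finsetSum _ fun k _ => (hA.tendsto_pow i k).abs.mul_const _
    exact le_antisymm (ge_of_tendsto' hlim hle) (integral_nonneg fun a => abs_nonneg _)
  have hall : ∀ i, ∀ᵐ a ∂μ, y t a i = y' t a i := by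
    intro i
    have := (integral_eq_zero_iff_of_nonneg (fun a => abs_nonneg _) (hL1 t i)).1 (hzero i)
    filter_upwards [this] with a ha
    exact sub_eq_zero.1 (abs_eq_zero.1 ha)
  filter_upwards [ae_all_iff.2 hall] with a ha
  exact funext ha

end Innovations

/-! ### Necessary form of a solution, and its spectral density -/

section Solutions
variable {S : Type*} [MeasurableSpace S] {μ : Measure S} {n l k n₁ n₂ r : ℕ}
  {z : ℤ → S → Fin l → ℝ} {M : LREM n l k} {y : ℤ → S → Fin n → ℝ} {η : ℤ → S → Fin k → ℝ}

theorem mul_mul_transpose_apply_self {m q : Type*} [Fintype q] (C : Matrix m q ℝ)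
    (V : Matrix q q ℝ) (i : m) : (C * V * Cᵀ) i i = C i ⬝ᵥ (V *ᵥ C i) := by
  rw [Matrix.mul_assoc]; rfl

/-- The variance matrix of the shocks is positive definite, so that no nontrivial linear
combination of them vanishes. -/
theorem IsShock.eq_zero_of_mulVec [IsProbabilityMeasure μ] (hz : IsShock μ z) {m : Type*}
    {C : Matrix m (Fin l) ℝ} {t : ℤ} (h : ∀ᵐ a ∂μ, C *ᵥ z t a = 0) : C = 0 := by
  have h2 : VecL2 μ (z t) := hz.memLp t
  have h0 : C * covMat μ (z t) (z t) * Cᵀ = 0 := by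
    rw [← covMat_mulVec_left h2 h2, ← covMat_mulVec_right (h2.mulVec C) h2,
      covMat_congr (X' := fun _ => 0) (Y' := fun _ => 0) h h]
    ext i j
    simp [covMat]
  ext i j
  by_contra hij
  have hne : C i ≠ 0 := fun hc => hij (by rw [hc]; rfl)
  have hpos := (hz.posDef t).dotProduct_mulVec_pos hne
  have := mul_mul_transpose_apply_self C (covMat μ (z t) (z t)) i
  rw [h0] at this
  simp only [star_trivial] at hpos
  exact absurd this.symm (ne_of_gt hpos)

theorem IsSolution.η_memLp (h : IsSolution M μ z y η) (t : ℤ) : VecL2 μ (η t) :=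
  fun i => h.stationary.memLp t (Sum.inr (Sum.inr i))

theorem IsSolution.y_stationary [IsProbabilityMeasure μ] (h : IsSolution M μ z y η) :
    CovStationary μ y :=
  h.stationary.map
    (LinearMap.pi fun i => LinearMap.proj (Sum.inr (Sum.inl i)) :
      (Fin l ⊕ (Fin n ⊕ Fin k) → ℝ) →ₗ[ℝ] (Fin n → ℝ))

/-- Linear combinations of shocks and expectation errors are jointly stationary. -/
theorem IsSolution.mulVec_stationary [IsProbabilityMeasure μ] (h : IsSolution M μ z y η)
    {m : Type*} [Fintype m] (A : Matrix m (Fin l) ℝ) (B : Matrix m (Fin k) ℝ) :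
    CovStationary μ fun t a => A *ᵥ z t a + B *ᵥ η t a :=
  h.stationary.map
    (A.mulVecLin ∘ₗ (LinearMap.pi fun i => LinearMap.proj (Sum.inl i)) +
      B.mulVecLin ∘ₗ (LinearMap.pi fun i => LinearMap.proj (Sum.inr (Sum.inr i))) :
      (Fin l ⊕ (Fin n ⊕ Fin k) → ℝ) →ₗ[ℝ] (m → ℝ))

theorem IsSolution.η_isInnovation [IsProbabilityMeasure μ] (hz : IsShock μ z)
    (h : IsSolution M μ z y η) : IsInnovation μ z η := by
  refine .of_scalar h.η_memLp hz.past_le fun t i => ?_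
  have hint : Integrable (η (t + 1)) μ :=
    Integrable.of_eval fun i => (h.η_memLp (t + 1) i).integrable (by norm_num)
  have h1 := ContinuousLinearMap.comp_condExp_comm (m := past z t) hint
    (ContinuousLinearMap.proj (R := ℝ) (φ := fun _ : Fin k => ℝ) i)
  refine h1.symm.trans ?_
  filter_upwards [h.η_mds t] with a ha
  simp [ha]

theorem IsSolution.disturbance_isInnovation [IsProbabilityMeasure μ] (hz : IsShock μ z)
    (h : IsSolution M μ z y η) {m : Type*} (A : Matrix m (Fin l) ℝ) (B : Matrix m (Fin k) ℝ) :
    IsInnovation μ z fun t a => A *ᵥ z t a + B *ᵥ η t a :=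
  (hz.isInnovation.mulVec A).add ((h.η_isInnovation hz).mulVec B)

/-- A solution stays in the stable subspace. -/
theorem IsSolution.Z₂_mulVec_eq_zero [IsProbabilityMeasure μ] (hz : IsShock μ z)
    (h : IsSolution M μ z y η) (D : StableQZ M n₁ n₂) (t : ℤ) : ∀ᵐ a ∂μ, D.Z₂ᵀ *ᵥ y t a = 0 := by
  refine ae_eq_zero_of_forward D.isStable_forward
    (w := fun t a => D.Z₂ᵀ *ᵥ y t a)
    (ξ := fun t a => (-(D.Ω₂₂⁻¹ * D.Q₂ * M.Ψ)) *ᵥ z t a + (-(D.Ω₂₂⁻¹ * D.Q₂ * M.Pi)) *ᵥ η t a)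
    (h.y_stationary.map D.Z₂ᵀ.mulVecLin) (fun t => measurable_mulVec (h.y_measurable t) _) (h.disturbance_isInnovation hz _ _)
    (fun t => ?_) t
  · filter_upwards [h.equation (t + 1)] with a ha
    rw [add_sub_cancel_right, add_assoc, D.equation_iff_blocks] at ha
    have h1 := congrArg (D.Ω₂₂⁻¹ *ᵥ ·) ha.2
    simp only [Matrix.mulVec_add, Matrix.mulVec_mulVec] at h1 ⊢
    rw [Matrix.nonsing_inv_mul_cancel_left _ _ D.isUnit_det_Ω₂₂] at h1
    simp only [Matrix.neg_mulVec, Matrix.mul_assoc]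
    rw [h1]
    abel

/-- The characterization of solutions: a restriction on the expectation errors and a stable
autoregression. -/
theorem IsSolution.reduced_form [IsProbabilityMeasure μ] (hz : IsShock μ z)
    (h : IsSolution M μ z y η) (D : StableQZ M n₁ n₂) (t : ℤ) :
    ∀ᵐ a ∂μ, D.Q₂ *ᵥ (M.Ψ *ᵥ z t a + M.Pi *ᵥ η t a) = 0 ∧
      y t a = D.Θ₁ *ᵥ y (t - 1) a + D.impact *ᵥ (M.Ψ *ᵥ z t a + M.Pi *ᵥ η t a) := by
  filter_upwards [h.equation t, h.Z₂_mulVec_eq_zero hz D t, h.Z₂_mulVec_eq_zero hz D (t - 1)]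
    with a h1 h2 h3
  rw [add_assoc] at h1
  exact (D.equation_iff h2 h3 _).1 h1

theorem IsSolution.existenceCondition [IsProbabilityMeasure μ] (hz : IsShock μ z)
    (h : IsSolution M μ z y η) (D : StableQZ M n₁ n₂) : D.ExistenceCondition := by
  rw [StableQZ.ExistenceCondition, matIm_le_iff]
  refine hz.eq_zero_of_mulVec (t := 0) ?_
  filter_upwards [h.reduced_form hz D 0] with a ha
  have h1 := congrArg ((1 - D.Q₂ * M.Pi * pinv (D.Q₂ * M.Pi)) *ᵥ ·) ha.1
  simp only [Matrix.mulVec_add, Matrix.mulVec_mulVec, Matrix.mulVec_zero,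
    one_sub_mul_pinv_mul, Matrix.zero_mulVec, add_zero] at h1
  exact h1

/-- The expectation errors of a solution are those of the standard solution plus a free part in
`ker (Q₂ Π)`. -/
theorem IsSolution.η_eq [IsProbabilityMeasure μ] (hz : IsShock μ z) (h : IsSolution M μ z y η)
    (D : StableQZ M n₁ n₂) {K : Matrix (Fin k) (Fin r) ℝ} (hK : IsKerBasis (D.Q₂ * M.Pi) K)
    (t : ℤ) : ∀ᵐ a ∂μ, η t a = D.Hstd *ᵥ z t a + K *ᵥ (pinv K *ᵥ (η t a - D.Hstd *ᵥ z t a)) := by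
  have hE := D.existenceCondition_iff.1 (h.existenceCondition hz D)
  filter_upwards [h.reduced_form hz D t] with a ha
  have h1 : (D.Q₂ * M.Pi) *ᵥ (η t a - D.Hstd *ᵥ z t a) = 0 := by
    have h2 := congrArg (· *ᵥ z t a) hE
    simp only [Matrix.mul_add, Matrix.add_mulVec, Matrix.zero_mulVec] at h2
    have h3 := ha.1
    simp only [Matrix.mulVec_add, Matrix.mulVec_mulVec] at h3
    rw [Matrix.mulVec_sub, Matrix.mulVec_mulVec, Matrix.mul_assoc, ← sub_eq_zero_of_eq (h3.trans h2.symm)]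
    abel
  rw [hK.mul_pinv_mulVec h1]
  abel

end Solutions

section Spectrum
variable {S : Type*} [MeasurableSpace S] {μ : Measure S} {n l : ℕ}
  {z : ℤ → S → Fin l → ℝ} {y u : ℤ → S → Fin n → ℝ} {A : Matrix (Fin n) (Fin n) ℝ}

/-- The spectral density of a stable first-order autoregression with innovation variance `V`. -/
def arSpectrum (A V : Matrix (Fin n) (Fin n) ℝ) (ω : ℝ) : Matrix (Fin n) (Fin n) ℂ :=
  (1 - Complex.exp (-(Complex.I * ω)) • toC A)⁻¹ * toC V *
    (1 - Complex.exp (Complex.I * ω) • (toC A)ᵀ)⁻¹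

theorem norm_exp_I_mul (ω : ℝ) : ‖Complex.exp (Complex.I * ω)‖ = 1 := by
  rw [mul_comm]; exact Complex.norm_exp_ofReal_mul_I ω

theorem norm_exp_neg_I_mul (ω : ℝ) : ‖Complex.exp (-(Complex.I * ω))‖ = 1 := by
  have := norm_exp_I_mul (-ω)
  rwa [Complex.ofReal_neg, mul_neg] at this

/-- With `γ(h) = A ^ h γ(0)` for `h ≥ 0`, the spectral density is the sum of two geometric
series, and the Lyapunov equation `γ(0) = A γ(0) Aᵀ + V` brings it into product form. -/
theorem isSpectralDensity_autoregression [IsProbabilityMeasure μ] (hA : IsSchurStable A)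
    (hy : CovStationary μ y) (hym : ∀ t, Measurable[past z t] (y t)) (hu : IsInnovation μ z u)
    (h : ∀ t, ∀ᵐ a ∂μ, y t a = A *ᵥ y (t - 1) a + u t a) :
    IsSpectralDensity μ y (arSpectrum A (covMat μ (u 0) (u 0))) := by
  have h2 : ∀ t, VecL2 μ (y t) := hy.memLp
  have hrefl : ∀ t, y t =ᵐ[μ] y t := fun t => Filter.EventuallyEq.refl _ _
  set γ := covMat μ (y 0) (y 0) with hγ
  set V := covMat μ (u 0) (u 0) with hV
  have hpos : ∀ j : ℕ, covMat μ (y j) (y 0) = A ^ j * γ := by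
    intro j
    induction j with
    | zero => simp [hγ]
    | succ j ih =>
      rw [covMat_congr (h _) (hrefl 0), covMat_add_left ((h2 _).mulVec A) (hu.memLp _) (h2 0),
        ← covMat_transpose (y 0) (u _), hu.covMat_eq_zero (by positivity) (hym 0) (h2 0),
        Matrix.transpose_zero, add_zero, covMat_mulVec_left (h2 _) (h2 0), pow_succ',
        Matrix.mul_assoc, ← ih]
      push_cast
      rw [add_sub_cancel_right]
  have hneg : ∀ j : ℕ, covMat μ (y (-(j : ℤ))) (y 0) = γ * (Aᵀ) ^ j := by
    intro j
    have e : covMat μ (y (-(j : ℤ))) (y 0) = covMat μ (y 0) (y j) := by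
      ext i k
      have := hy.cov (-(j : ℤ)) 0 j i k
      rw [neg_add_cancel, zero_add] at this
      exact this.symm
    have hγt : γᵀ = γ := covMat_transpose _ _
    rw [e, ← covMat_transpose, hpos, Matrix.transpose_mul, hγt, Matrix.transpose_pow]
  have hlyap : γ = A * γ * Aᵀ + V := by
    have e : covMat μ (y (0 - 1)) (y (0 - 1)) = γ := by
      ext i k
      have := hy.cov (0 - 1) (0 - 1) 1 i k
      rw [sub_add_cancel] at this
      exact this.symm
    have hAy := (h2 (0 - 1)).mulVec A
    have hyu : covMat μ (y (0 - 1)) (u 0) = 0 :=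
      hu.covMat_eq_zero (by norm_num) (hym _) (h2 _)
    conv_lhs => rw [hγ, covMat_congr (h 0) (h 0),
      covMat_add_left hAy (hu.memLp 0) (hAy.add (hu.memLp 0)),
      covMat_add_right hAy hAy (hu.memLp 0), covMat_add_right (hu.memLp 0) hAy (hu.memLp 0),
      ← covMat_transpose _ (u 0), covMat_mulVec_left (h2 _) (hu.memLp 0), hyu,
      covMat_mulVec_left (h2 _) hAy, covMat_mulVec_right (h2 _) (h2 _), e]
    simp [Matrix.mul_assoc, hV]
  intro ω
  set c := Complex.exp (-(Complex.I * ω)) with hc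
  set c' := Complex.exp (Complex.I * ω) with hc'
  have hcc : c * c' = 1 := by rw [hc, hc', ← Complex.exp_add]; simp
  set B := 1 - c • toC A with hB
  set B' := 1 - c' • (toC A)ᵀ with hB'
  have hBu : IsUnit B.det := hA.isUnit_det (norm_exp_neg_I_mul ω)
  have hB't : B' = (1 - c' • toC A)ᵀ := by
    rw [Matrix.transpose_sub, Matrix.transpose_one, Matrix.transpose_smul]
  have hB'u : IsUnit B'.det := by
    rw [hB't, Matrix.det_transpose]; exact hA.isUnit_det (norm_exp_I_mul ω)
  have hs1 : HasSum (fun j : ℕ => c ^ j • toC (covMat μ (y (j : ℤ)) (y 0))) (B⁻¹ * toC γ) := by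
    have := (hA.hasSum_geometric (norm_exp_neg_I_mul ω)).mul_right (toC γ)
    refine this.congr_fun fun j => ?_
    rw [hpos, toC_mul, toC_pow, Matrix.smul_mul]
  have hs2 : HasSum (fun j : ℕ => c' ^ (j + 1) • toC (covMat μ (y (-((j : ℤ) + 1))) (y 0)))
      (toC γ * (B'⁻¹ - 1)) := by
    have h1 := (hA.hasSum_geometric (norm_exp_I_mul ω)).matrix_transpose
    rw [Matrix.transpose_nonsing_inv, ← hB't] at h1
    have h3 := ((hasSum_nat_add_iff' 1).2 h1).mul_left (toC γ)
    simp only [Finset.range_one, Finset.sum_singleton, pow_zero, one_smul,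
      Matrix.transpose_one] at h3
    refine h3.congr_fun fun j => ?_
    have e : -((j : ℤ) + 1) = -((j + 1 : ℕ) : ℤ) := by push_cast; ring
    rw [e, hneg, toC_mul, toC_pow, Matrix.transpose_smul, Matrix.transpose_pow, Matrix.mul_smul]
    rfl
  have hsum : HasSum (fun j : ℤ => Complex.exp (-(Complex.I * j * ω)) •
      toC (covMat μ (y j) (y 0))) (B⁻¹ * toC γ + toC γ * (B'⁻¹ - 1)) := by
    refine HasSum.of_nat_of_neg_add_one ?_ ?_
    · refine hs1.congr_fun fun j => ?_
      rw [hc, ← Complex.exp_nat_mul]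
      congr 2
      push_cast
      ring
    · refine hs2.congr_fun fun j => ?_
      rw [hc', ← Complex.exp_nat_mul]
      congr 2
      push_cast
      ring
  have hf : arSpectrum A V ω = B⁻¹ * toC γ + toC γ * (B'⁻¹ - 1) := by
    have e1 : toC V = toC γ * B' + B * toC γ - B * toC γ * B' := by
      have : toC γ = toC A * toC γ * (toC A)ᵀ + toC V := by
        conv_lhs => rw [hlyap]
        rw [show toC (A * γ * Aᵀ + V) = toC (A * γ * Aᵀ) + toC V from
          Matrix.map_add _ Complex.ofReal_add _ _, toC_mul, toC_mul]
        rfl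
      have e2 : toC V = toC γ - (c * c') • (toC A * toC γ * (toC A)ᵀ) := by
        rw [hcc, one_smul]
        exact eq_sub_of_add_eq' this.symm
      rw [e2, hB, hB']
      simp only [Matrix.mul_sub, Matrix.sub_mul, Matrix.mul_one, Matrix.one_mul, Matrix.mul_smul,
        Matrix.smul_mul, smul_sub, smul_smul]
      rw [mul_comm c' c]
      abel
    rw [arSpectrum, ← hc, ← hc', ← hB, ← hB', e1, Matrix.mul_sub, Matrix.mul_add, Matrix.sub_mul,
      Matrix.add_mul]
    simp only [Matrix.mul_assoc]
    rw [Matrix.mul_nonsing_inv _ hB'u, Matrix.nonsing_inv_mul_cancel_left _ _ hBu, Matrix.mul_one,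
      Matrix.nonsing_inv_mul_cancel_left _ _ hBu, Matrix.mul_sub, Matrix.mul_one]
    abel
  intro i j
  rw [hf]
  have := Pi.hasSum.1 (Pi.hasSum.1 hsum i) j
  refine this.congr_fun fun h => ?_
  simp only [Matrix.smul_apply, smul_eq_mul]
  rw [mul_comm]
  rfl

theorem IsSpectralDensity.unique {f g : ℝ → Matrix (Fin n) (Fin n) ℂ}
    (hf : IsSpectralDensity μ y f) (hg : IsSpectralDensity μ y g) : f = g := by
  ext ω i j
  exact (hf ω i j).unique (hg ω i j)

end Spectrum

/-! ### The loss as a linear function of the innovation variance -/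

section Loss
variable {n : ℕ} {W : ℝ → Matrix (Fin n) (Fin n) ℂ} {A : Matrix (Fin n) (Fin n) ℝ}

/-- Entrywise integrability over `[-π, π]`. -/
def MatIntegrable {p q : Type*} (F : ℝ → Matrix p q ℂ) : Prop :=
  ∀ i j, IntervalIntegrable (fun ω => F ω i j) volume (-Real.pi) Real.pi

theorem intervalIntegrable_fun_sum {ι F : Type*} [Fintype ι] [NormedAddCommGroup F]
    {f : ι → ℝ → F} {a b : ℝ}
    (h : ∀ i, IntervalIntegrable (f i) volume a b) :
    IntervalIntegrable (fun ω => ∑ i, f i ω) volume a b := by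
  have := IntervalIntegrable.sum Finset.univ (f := f) fun i _ => h i
  simpa only [Finset.sum_fn] using this

theorem MatIntegrable.mul_continuous {p q r : Type*} [Fintype q] {F : ℝ → Matrix p q ℂ}
    {G : ℝ → Matrix q r ℂ} (hF : MatIntegrable F) (hG : Continuous G) :
    MatIntegrable fun ω => F ω * G ω := by
  intro i j
  simp only [Matrix.mul_apply]
  exact intervalIntegrable_fun_sum fun k =>
    (hF i k).mul_continuousOn (hG.matrix_elem k j).continuousOn

theorem MatIntegrable.continuous_mul {p q r : Type*} [Fintype q] {F : ℝ → Matrix p q ℂ}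
    {G : ℝ → Matrix q r ℂ} (hF : Continuous F) (hG : MatIntegrable G) :
    MatIntegrable fun ω => F ω * G ω := by
  intro i j
  simp only [Matrix.mul_apply]
  exact intervalIntegrable_fun_sum fun k =>
    (hG k j).continuousOn_mul (hF.matrix_elem i k).continuousOn

theorem IsWeight.matIntegrable (hW : IsWeight W) : MatIntegrable W := by
  intro i j
  obtain ⟨C, hC⟩ := hW.bounded
  refine (intervalIntegrable_const (c := C)).mono_fun
    (hW.measurable i j).aestronglyMeasurable ?_
  rw [Set.uIoc_of_le (by linarith [Real.pi_pos])]
  filter_upwards [ae_restrict_mem measurableSet_Ioc] with ω hω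
  exact (hC ω hω i j).trans (le_abs_self C)

/-- The resolvent `(I - A e^{-iω})⁻¹`. -/
def arResolvent (A : Matrix (Fin n) (Fin n) ℝ) (ω : ℝ) : Matrix (Fin n) (Fin n) ℂ :=
  (1 - Complex.exp (-(Complex.I * ω)) • toC A)⁻¹

theorem conjTranspose_arResolvent (A : Matrix (Fin n) (Fin n) ℝ) (ω : ℝ) :
    (arResolvent A ω)ᴴ = (1 - Complex.exp (Complex.I * ω) • (toC A)ᵀ)⁻¹ := by
  have hA : (toC A)ᴴ = (toC A)ᵀ := by ext i j; simp
  have he : star (Complex.exp (-(Complex.I * ω))) = Complex.exp (Complex.I * ω) := by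
    rw [Complex.star_def, ← Complex.exp_conj]; simp
  rw [arResolvent, Matrix.conjTranspose_nonsing_inv, Matrix.conjTranspose_sub,
    Matrix.conjTranspose_one, Matrix.conjTranspose_smul, hA, he]

theorem IsSchurStable.continuous_arResolvent (hA : IsSchurStable A) :
    Continuous (arResolvent A) := by
  have hc : Continuous fun ω : ℝ => 1 - Complex.exp (-(Complex.I * ω)) • toC A := by fun_prop
  have e : arResolvent A = fun ω : ℝ => ((1 - Complex.exp (-(Complex.I * ω)) • toC A).det)⁻¹ •
      (1 - Complex.exp (-(Complex.I * ω)) • toC A).adjugate := by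
    ext1 ω
    rw [arResolvent, Matrix.inv_def, Ring.inverse_eq_inv']
  rw [e]
  exact (hc.matrix_det.inv₀ fun ω => (hA.isUnit_det (norm_exp_neg_I_mul ω)).ne_zero).smul
    hc.matrix_adjugate

/-- The weight matrix of an autoregression: the loss is a linear function of the innovation
variance, with this coefficient. -/
def arWeight (A : Matrix (Fin n) (Fin n) ℝ) (W : ℝ → Matrix (Fin n) (Fin n) ℂ) :
    Matrix (Fin n) (Fin n) ℝ :=
  (((1 / (2 * Real.pi) : ℝ) : ℂ) • matIntegral fun ω =>
    (arResolvent A ω)ᴴ * W ω * arResolvent A ω).map Complex.re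

theorem IsSchurStable.matIntegrable_weight (hA : IsSchurStable A) (hW : IsWeight W) :
    MatIntegrable fun ω => (arResolvent A ω)ᴴ * W ω * arResolvent A ω :=
  (MatIntegrable.continuous_mul hA.continuous_arResolvent.matrix_conjTranspose
    hW.matIntegrable).mul_continuous hA.continuous_arResolvent

theorem IsSchurStable.arWeight_apply (hA : IsSchurStable A) (hW : IsWeight W) (i j : Fin n) :
    arWeight A W i j = 1 / (2 * Real.pi) *
      ∫ ω in (-Real.pi)..Real.pi, (((arResolvent A ω)ᴴ * W ω * arResolvent A ω) i j).re := by
  have h := Complex.reCLM.intervalIntegral_comp_comm (hA.matIntegrable_weight hW i j)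
  simp only [Complex.reCLM_apply] at h
  rw [h]
  simp only [arWeight, Matrix.map_apply, Matrix.smul_apply, smul_eq_mul, matIntegral,
    Matrix.of_apply, Complex.re_ofReal_mul]

theorem IsSchurStable.loss_arSpectrum (hA : IsSchurStable A) (hW : IsWeight W)
    (V : Matrix (Fin n) (Fin n) ℝ) :
    loss W (arSpectrum A V) = 1 / 2 * (arWeight A W * V).trace := by
  set X := fun ω => (arResolvent A ω)ᴴ * W ω * arResolvent A ω with hX
  have hXi : MatIntegrable X := hA.matIntegrable_weight hW
  have hf : arSpectrum A V = fun ω => arResolvent A ω * toC V * (arResolvent A ω)ᴴ := by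
    ext1 ω
    rw [arSpectrum, conjTranspose_arResolvent, arResolvent]
  have hWf : MatIntegrable fun ω => W ω * arSpectrum A V ω := by
    rw [hf]
    exact hW.matIntegrable.mul_continuous
      ((hA.continuous_arResolvent.matrix_mul continuous_const).matrix_mul
        hA.continuous_arResolvent.matrix_conjTranspose)
  have htr : (matIntegral fun ω => W ω * arSpectrum A V ω).trace =
      ∑ i, ∑ j, matIntegral X i j * (V j i : ℂ) := by
    have e1 : (matIntegral fun ω => W ω * arSpectrum A V ω).trace =
        ∫ ω in (-Real.pi)..Real.pi, (W ω * arSpectrum A V ω).trace := by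
      simp only [Matrix.trace, Matrix.diag_apply, matIntegral, Matrix.of_apply]
      rw [intervalIntegral.integral_finsetSum fun i _ => hWf i i]
    have e2 : ∀ ω, (W ω * arSpectrum A V ω).trace = ∑ i, ∑ j, X ω i j * (V j i : ℂ) := by
      intro ω
      have : (W ω * arSpectrum A V ω).trace = (X ω * toC V).trace := by
        rw [hf, hX]
        simp only
        rw [← Matrix.mul_assoc, Matrix.trace_mul_comm]
        simp only [Matrix.mul_assoc]
      rw [this]
      rfl
    rw [e1]
    simp only [e2]
    rw [intervalIntegral.integral_finsetSum fun i _ =>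
      intervalIntegrable_fun_sum fun j => (hXi i j).mul_const _]
    refine Finset.sum_congr rfl fun i _ => ?_
    rw [intervalIntegral.integral_finsetSum fun j _ => (hXi i j).mul_const _]
    refine Finset.sum_congr rfl fun j _ => ?_
    rw [intervalIntegral.integral_mul_const]
    rfl
  rw [loss, Matrix.trace_smul, htr]
  congr 1
  simp only [arWeight, Matrix.trace, Matrix.diag_apply, Matrix.mul_apply, Matrix.map_apply,
    Matrix.smul_apply, smul_eq_mul, Finset.mul_sum, Complex.re_sum]
  refine Finset.sum_congr rfl fun i _ => Finset.sum_congr rfl fun j _ => ?_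
  rw [← mul_assoc, Complex.re_mul_ofReal]

theorem IsSchurStable.posSemidef_arWeight (hA : IsSchurStable A) (hW : IsWeight W) :
    (arWeight A W).PosSemidef := by
  have hpi : -Real.pi ≤ Real.pi := by linarith [Real.pi_pos]
  have hX : ∀ ω ∈ Set.Ioc (-Real.pi) Real.pi,
      ((arResolvent A ω)ᴴ * W ω * arResolvent A ω).PosSemidef := fun ω hω =>
    (hW.posSemidef ω hω).conjTranspose_mul_mul_same _
  refine Matrix.PosSemidef.of_dotProduct_mulVec_nonneg ?_ fun v => ?_
  · ext i j
    rw [Matrix.conjTranspose_apply, star_trivial, hA.arWeight_apply hW, hA.arWeight_apply hW]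
    congr 1
    refine intervalIntegral.integral_congr_ae (Filter.Eventually.of_forall fun ω hω => ?_)
    rw [Set.uIoc_of_le hpi] at hω
    rw [← (hX ω hω).1.apply i j, Complex.star_def, Complex.conj_re]
  · have e : star v ⬝ᵥ (arWeight A W *ᵥ v) = 1 / (2 * Real.pi) * ∫ ω in (-Real.pi)..Real.pi,
        ∑ i, ∑ j, v i * v j * (((arResolvent A ω)ᴴ * W ω * arResolvent A ω) i j).re := by
      have hi : ∀ i j, IntervalIntegrable (fun ω => v i * v j *
          (((arResolvent A ω)ᴴ * W ω * arResolvent A ω) i j).re) volume (-Real.pi) Real.pi :=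
        fun i j => IntervalIntegrable.const_mul
          ⟨(hA.matIntegrable_weight hW i j).1.re, (hA.matIntegrable_weight hW i j).2.re⟩ _
      rw [intervalIntegral.integral_finsetSum fun i _ =>
        intervalIntegrable_fun_sum fun j => hi i j, Finset.mul_sum]
      simp only [dotProduct, Matrix.mulVec, star_trivial]
      refine Finset.sum_congr rfl fun i _ => ?_
      rw [intervalIntegral.integral_finsetSum fun j _ => hi i j, Finset.mul_sum, Finset.mul_sum]
      refine Finset.sum_congr rfl fun j _ => ?_
      rw [intervalIntegral.integral_const_mul, hA.arWeight_apply hW]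
      ring
    rw [e]
    refine mul_nonneg (by positivity) (intervalIntegral.integral_nonneg_of_ae_restrict hpi ?_)
    have hae : ∀ᵐ ω ∂volume.restrict (Set.Icc (-Real.pi) Real.pi),
        ω ∈ Set.Ioc (-Real.pi) Real.pi := by
      rw [← restrict_Ioc_eq_restrict_Icc]
      exact ae_restrict_mem measurableSet_Ioc
    filter_upwards [hae] with ω hω
    have h := (hX ω hω).dotProduct_mulVec_nonneg (fun i => (v i : ℂ))
    have h' := (Complex.le_def.1 h).1
    simp only [dotProduct, Matrix.mulVec, Finset.mul_sum, Complex.re_sum, Pi.star_apply,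
      Complex.star_def, Complex.conj_ofReal, Complex.zero_re, Complex.re_ofReal_mul,
      Complex.re_mul_ofReal] at h'
    refine h'.trans (le_of_eq ?_)
    refine Finset.sum_congr rfl fun i _ => Finset.sum_congr rfl fun j _ => ?_
    ring

open scoped MatrixOrder in
theorem Matrix.PosSemidef.exists_transpose_mul_self {m : ℕ} {X : Matrix (Fin m) (Fin m) ℝ}
    (hX : X.PosSemidef) : ∃ R : Matrix (Fin m) (Fin m) ℝ, X = Rᵀ * R :=
  CStarAlgebra.nonneg_iff_eq_star_mul_self.1 hX.nonneg

theorem StableQZ.Ξ_eq {l k n₁ n₂ : ℕ} {M : LREM n l k} (D : StableQZ M n₁ n₂)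
    (W : ℝ → Matrix (Fin n) (Fin n) ℂ) : D.Ξ W = arWeight D.Θ₁ W := by
  simp only [arWeight, conjTranspose_arResolvent]
  rfl

end Loss

/-! ### Moving averages of the shocks, and construction of solutions -/

section MovingAverage
variable {S : Type*} [MeasurableSpace S] {μ : Measure S} {n l : ℕ} {z : ℤ → S → Fin l → ℝ}

/-- A series of random variables with absolutely summable coefficients and bounded second moments
converges absolutely almost surely. -/
theorem ae_summable_mul [IsProbabilityMeasure μ] {c : ℕ → ℝ} (hc : Summable fun j => |c j|)
    {X : ℕ → S → ℝ} (hX : ∀ j, MemLp (X j) 2 μ) {C : ENNReal} (hC : C ≠ ⊤)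
    (hb : ∀ j, eLpNorm (X j) 2 μ ≤ C) : ∀ᵐ a ∂μ, Summable fun j => c j * X j a := by
  have hcs : ∑' j, ‖c j‖ₑ ≠ ⊤ := by
    have : Summable fun j => ‖c j‖₊ := by
      rw [← NNReal.summable_coe]; simpa using hc
    exact ENNReal.tsum_coe_ne_top_iff_summable.2 this
  have hm : ∀ j, AEMeasurable (fun a => ‖c j * X j a‖ₑ) μ := fun j =>
    ((hX j).aestronglyMeasurable.const_mul (c j)).enorm
  have hfin : ∫⁻ a, ∑' j, ‖c j * X j a‖ₑ ∂μ ≠ ⊤ := by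
    rw [lintegral_tsum hm]
    refine ne_top_of_le_ne_top (ENNReal.mul_ne_top hcs hC) ?_
    rw [← ENNReal.tsum_mul_right]
    refine ENNReal.tsum_le_tsum fun j => ?_
    simp only [enorm_mul]
    rw [lintegral_const_mul'' _ (hX j).aestronglyMeasurable.enorm, ← eLpNorm_one_eq_lintegral_enorm]
    gcongr
    exact (eLpNorm_le_eLpNorm_of_exponent_le (by norm_num) (hX j).aestronglyMeasurable).trans (hb j)
  filter_upwards [ae_lt_top' (AEMeasurable.tsum hm) hfin] with a ha
  have h1 : Summable fun j => ‖c j * X j a‖₊ := ENNReal.tsum_coe_ne_top_iff_summable.1 ha.ne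
  exact h1.of_nnnorm

/-- The sum of such a series is square integrable. -/
theorem memLp_of_tendsto_sum_mul {c : ℕ → ℝ} (hc : Summable fun j => |c j|)
    {X : ℕ → S → ℝ} (hX : ∀ j, MemLp (X j) 2 μ) {C : ENNReal} (hC : C ≠ ⊤)
    (hb : ∀ j, eLpNorm (X j) 2 μ ≤ C) {Y : S → ℝ} (hY : ∀ᵐ a ∂μ, Filter.Tendsto
      (fun N => ∑ j ∈ Finset.range N, c j * X j a) Filter.atTop (nhds (Y a))) : MemLp Y 2 μ := by
  have hcs : ∑' j, ‖c j‖ₑ ≠ ⊤ := by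
    have : Summable fun j => ‖c j‖₊ := by
      rw [← NNReal.summable_coe]; simpa using hc
    exact ENNReal.tsum_coe_ne_top_iff_summable.2 this
  have hm : ∀ N, AEStronglyMeasurable (fun a => ∑ j ∈ Finset.range N, c j * X j a) μ := fun N =>
    Finset.aestronglyMeasurable_fun_sum _ fun j _ => (hX j).aestronglyMeasurable.const_mul (c j)
  refine ⟨aestronglyMeasurable_of_tendsto_ae Filter.atTop hm hY, ?_⟩
  have hle : ∀ N, eLpNorm (fun a => ∑ j ∈ Finset.range N, c j * X j a) 2 μ ≤
      (∑' j, ‖c j‖ₑ) * C := by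
    intro N
    have e : (fun a => ∑ j ∈ Finset.range N, c j * X j a) =
        ∑ j ∈ Finset.range N, c j • X j := by
      ext a; simp
    rw [e]
    refine (eLpNorm_sum_le (fun j _ => (hX j).aestronglyMeasurable.const_smul (c j))
      (by norm_num)).trans ?_
    calc ∑ j ∈ Finset.range N, eLpNorm (c j • X j) 2 μ
        ≤ ∑ j ∈ Finset.range N, ‖c j‖ₑ * C := Finset.sum_le_sum fun j _ => by
          rw [eLpNorm_const_smul]; gcongr; exact hb j
      _ ≤ ∑' j, ‖c j‖ₑ * C := ENNReal.sum_le_tsum _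
      _ = _ := ENNReal.tsum_mul_right
  have := Lp.eLpNorm_lim_le_liminf_eLpNorm hm Y hY (p := 2)
  refine lt_of_le_of_lt (this.trans ?_) (lt_top_iff_ne_top.2 (ENNReal.mul_ne_top hcs hC))
  exact Filter.liminf_le_of_le (by isBoundedDefault) fun b hb' => by
    obtain ⟨N, hN⟩ := hb'.exists
    exact hN.trans (hle N)

/-- The infinite sum `∑ⱼ c(j) p(j)` of vectors, as a function of the sequence `p`. It is defined by a
limit of partial sums, with a junk value where that limit does not exist; this makes it a
measurable function on all of sequence space. -/
def maSum (c : ℕ → Matrix (Fin n) (Fin l) ℝ) (p : ℕ → Fin l → ℝ) : Fin n → ℝ :=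
  fun i => Filter.limUnder Filter.atTop fun N => ∑ j ∈ Finset.range N, (c j *ᵥ p j) i

theorem measurable_maSum {T : Type*} {m : MeasurableSpace T} (c : ℕ → Matrix (Fin n) (Fin l) ℝ)
    {p : ℕ → T → Fin l → ℝ} (hp : ∀ j, Measurable (p j)) :
    Measurable fun a => maSum c fun j => p j a := by
  refine measurable_pi_iff.2 fun i => ?_
  refine (StronglyMeasurable.limUnder (l := Filter.atTop)
    (f := fun N a => ∑ j ∈ Finset.range N, (c j *ᵥ p j a) i) fun N => ?_).measurable
  exact (Finset.measurable_fun_sum _ fun j _ =>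
    (measurable_pi_apply i).comp (measurable_mulVec (hp j) (c j))).stronglyMeasurable

/-- Shifting the shocks in time does not change the law of their path. -/
theorem IsShock.map_path_shift [IsProbabilityMeasure μ] (hz : IsShock μ z) (h : ℤ) :
    μ.map (fun a (s : ℤ) => z (h + s) a) = μ.map fun a (s : ℤ) => z s a := by
  have h1 : iIndepFun (fun s : ℤ => z (h + s)) μ :=
    hz.indep.precomp (g := fun s : ℤ => h + s) (add_right_injective h)
  rw [h1.map_fun_eq_infinitePi_map fun s => hz.measurable _,
    hz.indep.map_fun_eq_infinitePi_map hz.measurable]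
  congr 1
  ext1 s
  exact (hz.ident (h + s) s).map_eq

/-- A process that is a time-invariant function of the path of the shocks is stationary. -/
theorem IsShock.covStationary_of_path [IsProbabilityMeasure μ] (hz : IsShock μ z) {ι : Type*}
    {x : ℤ → S → ι → ℝ} (hx : ∀ t, VecL2 μ (x t)) {G : (ℤ → Fin l → ℝ) → ι → ℝ}
    (hG : Measurable G) (h : ∀ t a, x t a = G fun s => z (t + s) a) : CovStationary μ x := by
  have hpath : ∀ t : ℤ, Measurable fun a (s : ℤ) => z (t + s) a := fun t =>
    measurable_pi_iff.2 fun s => hz.measurable _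
  have hpath0 : Measurable fun a (s : ℤ) => z s a := measurable_pi_iff.2 fun s => hz.measurable _
  refine ⟨hx, ?_, ?_⟩
  · have key : ∀ t i, ∫ a, x t a i ∂μ = ∫ a, G (fun s => z s a) i ∂μ := by
      intro t i
      simp only [h]
      have hGi : ∀ ν : Measure (ℤ → Fin l → ℝ), AEStronglyMeasurable (fun p => G p i) ν := fun ν =>
        ((measurable_pi_apply i).comp hG).aestronglyMeasurable
      rw [← integral_map (φ := fun a (s : ℤ) => z (t + s) a) (hpath t).aemeasurable (hGi _),
        hz.map_path_shift t, integral_map hpath0.aemeasurable (hGi _)]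
    intro s t i
    rw [key, key]
  · intro s t h' i j
    have hsh : ∀ (r : ℤ) i, Measurable fun p : ℤ → Fin l → ℝ => G (fun s => p (r + s)) i := fun r i =>
      (measurable_pi_apply i).comp (hG.comp (measurable_pi_iff.2 fun s => measurable_pi_apply _))
    have key : ∀ h : ℤ, cov[fun a => x (s + h) a i, fun a => x (t + h) a j; μ] =
        cov[fun p => G (fun r => p (s + r)) i, fun p => G (fun r => p (t + r)) j;
          μ.map fun a (s : ℤ) => z s a] := by
      intro h'
      rw [← hz.map_path_shift h', covariance_map_fun (hsh s i).aestronglyMeasurable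
        (hsh t j).aestronglyMeasurable (hpath h').aemeasurable]
      simp only [h]
      have e : ∀ (r : ℤ) (a : S), (fun s' : ℤ => z (r + h' + s') a) =
          fun s' : ℤ => z (h' + (r + s')) a := fun r a => by
        ext1 s'
        rw [add_comm r h', add_assoc]
      simp only [e]
    have e0 := key 0
    simp only [add_zero] at e0
    rw [key h', e0]

end MovingAverage

/-- The stationary solution `∑ⱼ Aʲ B z(t-j)` of the autoregression driven by `B z(t)`. -/
def maProcess {S : Type*} {n l : ℕ} (A : Matrix (Fin n) (Fin n) ℝ) (B : Matrix (Fin n) (Fin l) ℝ)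
    (z : ℤ → S → Fin l → ℝ) (t : ℤ) (a : S) : Fin n → ℝ :=
  maSum (fun j => A ^ j * B) fun j => z (t + -(j : ℤ)) a

theorem maProcess_measurable {S : Type*} {n l : ℕ} (A : Matrix (Fin n) (Fin n) ℝ)
    (B : Matrix (Fin n) (Fin l) ℝ) (z : ℤ → S → Fin l → ℝ) (t : ℤ) :
    Measurable[past z t] (maProcess A B z t) :=
  measurable_maSum (m := past z t) _ fun j => measurable_past z (by omega)

section Construction
variable {S : Type*} [MeasurableSpace S] {μ : Measure S} {n l k n₁ n₂ : ℕ}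
  {z : ℤ → S → Fin l → ℝ} {M : LREM n l k} {A : Matrix (Fin n) (Fin n) ℝ}

theorem IsSchurStable.summable_abs_mul (hA : IsSchurStable A) (B : Matrix (Fin n) (Fin l) ℝ)
    (i : Fin n) (k : Fin l) : Summable fun j : ℕ => |(A ^ j * B) i k| := by
  refine Summable.of_nonneg_of_le (fun _ => abs_nonneg _) (fun j => ?_)
    (summable_sum (s := Finset.univ) fun m _ => (hA.summable_abs i m).mul_right |B m k|)
  rw [Matrix.mul_apply]
  refine (Finset.abs_sum_le_sum_abs _ _).trans (le_of_eq ?_)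
  simp only [abs_mul]

theorem IsShock.eLpNorm_eq (hz : IsShock μ z) (t : ℤ) (i : Fin l) :
    eLpNorm (fun a => z t a i) 2 μ = eLpNorm (fun a => z 0 a i) 2 μ :=
  ((hz.ident t 0).comp (measurable_pi_apply i)).eLpNorm_eq 2

theorem maProcess_tendsto [IsProbabilityMeasure μ] (hz : IsShock μ z) (hA : IsSchurStable A)
    (B : Matrix (Fin n) (Fin l) ℝ) (t : ℤ) : ∀ᵐ a ∂μ, ∀ i, Filter.Tendsto
      (fun N => ∑ j ∈ Finset.range N, ((A ^ j * B) *ᵥ z (t + -(j : ℤ)) a) i) Filter.atTop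
      (nhds (maProcess A B z t a i)) := by
  have h1 : ∀ i k, ∀ᵐ a ∂μ, Summable fun j : ℕ => (A ^ j * B) i k * z (t + -(j : ℤ)) a k :=
    fun i k => ae_summable_mul (hA.summable_abs_mul B i k) (fun j => hz.memLp _ k)
      (hz.memLp 0 k).2.ne fun j => (hz.eLpNorm_eq _ k).le
  filter_upwards [ae_all_iff.2 fun i => ae_all_iff.2 (h1 i)] with a ha i
  have h2 : Summable fun j : ℕ => ((A ^ j * B) *ᵥ z (t + -(j : ℤ)) a) i := by
    simp only [Matrix.mulVec, dotProduct]
    exact summable_sum fun k _ => ha i k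
  exact tendsto_nhds_limUnder ⟨_, h2.hasSum.tendsto_sum_nat⟩

theorem maProcess_memLp [IsProbabilityMeasure μ] (hz : IsShock μ z) (hA : IsSchurStable A)
    (B : Matrix (Fin n) (Fin l) ℝ) (t : ℤ) : VecL2 μ (maProcess A B z t) := by
  have h1 : ∀ i k, ∀ᵐ a ∂μ, Summable fun j : ℕ => (A ^ j * B) i k * z (t + -(j : ℤ)) a k :=
    fun i k => ae_summable_mul (hA.summable_abs_mul B i k) (fun j => hz.memLp _ k)
      (hz.memLp 0 k).2.ne fun j => (hz.eLpNorm_eq _ k).le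
  intro i
  have h2 : ∀ k, MemLp (fun a => ∑' j : ℕ, (A ^ j * B) i k * z (t + -(j : ℤ)) a k) 2 μ := fun k =>
    memLp_of_tendsto_sum_mul (hA.summable_abs_mul B i k)
      (X := fun j a => z (t + -(j : ℤ)) a k) (fun j => hz.memLp _ k)
      (hz.memLp 0 k).2.ne (fun j => (hz.eLpNorm_eq _ k).le)
      ((h1 i k).mono fun a ha => ha.hasSum.tendsto_sum_nat)
  refine (memLp_finsetSum Finset.univ fun k _ => h2 k).ae_eq ?_
  filter_upwards [ae_all_iff.2 (h1 i), maProcess_tendsto hz hA B t] with a ha hlim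
  refine tendsto_nhds_unique ?_ (hlim i)
  have h3 := tendsto_finsetSum Finset.univ fun k (_ : k ∈ Finset.univ) =>
    (ha k).hasSum.tendsto_sum_nat
  refine h3.congr fun N => ?_
  rw [Finset.sum_comm]
  rfl

theorem maProcess_eq [IsProbabilityMeasure μ] (hz : IsShock μ z) (hA : IsSchurStable A)
    (B : Matrix (Fin n) (Fin l) ℝ) (t : ℤ) :
    ∀ᵐ a ∂μ, maProcess A B z t a = A *ᵥ maProcess A B z (t - 1) a + B *ᵥ z t a := by
  filter_upwards [maProcess_tendsto hz hA B t, maProcess_tendsto hz hA B (t - 1)] with a h1 h2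
  ext i
  refine tendsto_nhds_unique ((h1 i).comp (Filter.tendsto_add_atTop_nat 1)) ?_
  have h3 : Filter.Tendsto (fun N => ∑ m, A i m *
      ∑ j ∈ Finset.range N, ((A ^ j * B) *ᵥ z (t - 1 + -(j : ℤ)) a) m) Filter.atTop
      (nhds ((A *ᵥ maProcess A B z (t - 1) a) i)) :=
    tendsto_finsetSum _ fun m _ => (h2 m).const_mul _
  refine (h3.add_const ((B *ᵥ z t a) i)).congr fun N => ?_
  simp only [Function.comp_apply]
  rw [Finset.sum_range_succ']
  congr 1
  · simp only [Finset.mul_sum]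
    rw [Finset.sum_comm]
    refine Finset.sum_congr rfl fun j _ => ?_
    have e : t + -((j + 1 : ℕ) : ℤ) = t - 1 + -(j : ℤ) := by push_cast; ring
    rw [e, pow_succ', Matrix.mul_assoc, ← Matrix.mulVec_mulVec _ A]
    rfl
  · simp

theorem IsShock.condExp_mulVec [IsProbabilityMeasure μ] (hz : IsShock μ z)
    (H : Matrix (Fin k) (Fin l) ℝ) (t : ℤ) :
    μ[fun a => H *ᵥ z (t + 1) a | past z t] =ᵐ[μ] 0 := by
  have h := condExp_indep_eq (hz.measurable (t + 1)).comap_le (hz.past_le t)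
    (f := fun a => H *ᵥ z (t + 1) a)
    (measurable_mulVec (comap_measurable (z (t + 1))) H).stronglyMeasurable
    (hz.indep_past t)
  refine h.trans (Filter.EventuallyEq.of_eq (funext fun _ => ?_))
  have h2 : VecL2 μ (z (t + 1)) := hz.memLp _
  ext i
  rw [eval_integral fun i => (h2.mulVec H i).integrable (by norm_num)]
  have h3 := congrFun (meanVec_mulVec h2 H) i
  have h4 : meanVec μ (z (t + 1)) = 0 := funext (hz.mean_zero (t + 1))
  rw [h4, Matrix.mulVec_zero] at h3
  exact h3

/-- Any linear choice `η(t) = H z(t)` of the expectation errors that respects the restriction in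
the unstable block extends to a solution. -/
theorem exists_isSolution [IsProbabilityMeasure μ] (hz : IsShock μ z) (D : StableQZ M n₁ n₂)
    {H : Matrix (Fin k) (Fin l) ℝ} (hH : D.Q₂ * (M.Ψ + M.Pi * H) = 0) :
    ∃ y, IsSolution M μ z y fun t a => H *ᵥ z t a := by
  set B := D.impact * (M.Ψ + M.Pi * H) with hB
  have hA := D.isStable_Θ₁
  set y := maProcess D.Θ₁ B z with hy
  have hZ : ∀ t, ∀ᵐ a ∂μ, D.Z₂ᵀ *ᵥ y t a = 0 := by
    intro t
    filter_upwards [maProcess_eq hz hA B t] with a ha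
    rw [hy, ha, Matrix.mulVec_add, Matrix.mulVec_mulVec, Matrix.mulVec_mulVec, D.Z₂_Θ₁, hB,
      ← Matrix.mul_assoc, D.Z₂_impact]
    simp
  refine ⟨y, maProcess_measurable _ B z, fun t => ?_, fun t => ?_, ?_, fun t => ?_⟩
  · exact measurable_mulVec (measurable_past z le_rfl) H
  · exact hz.condExp_mulVec H t
  · refine hz.covStationary_of_path (G := fun p => Sum.elim (p 0)
      (Sum.elim (maSum (fun j => D.Θ₁ ^ j * B) fun j => p (-(j : ℤ))) (H *ᵥ p 0))) ?_ ?_ ?_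
    · rintro t (i | i | i)
      · exact hz.memLp t i
      · exact maProcess_memLp hz hA B t i
      · exact VecL2.mulVec (hz.memLp t) H i
    · refine measurable_pi_iff.2 ?_
      rintro (i | i | i)
      · exact (measurable_pi_apply i).comp (measurable_pi_apply 0)
      · exact (measurable_pi_apply i).comp (measurable_maSum _ fun j => measurable_pi_apply _)
      · exact (measurable_pi_apply i).comp (measurable_mulVec (measurable_pi_apply 0) H)
    · intro t a
      simp only [add_zero]
      rfl
  · filter_upwards [maProcess_eq hz hA B t, hZ t, hZ (t - 1)] with a h1 h2 h3
    rw [add_assoc]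
    refine (D.equation_iff h2 h3 _).2 ⟨?_, ?_⟩
    · have := congrArg (· *ᵥ z t a) hH
      simpa only [Matrix.mul_add, Matrix.add_mulVec, Matrix.mulVec_add, Matrix.mulVec_mulVec,
        Matrix.zero_mulVec] using this
    · rw [hy, h1, hB]
      simp only [Matrix.mul_add, Matrix.add_mulVec, Matrix.mulVec_add, Matrix.mulVec_mulVec]

end Construction

/-! ### Minimization of the loss -/

section Regularization
variable {S : Type*} [MeasurableSpace S] {μ : Measure S} {n l k n₁ n₂ r : ℕ}
  {z : ℤ → S → Fin l → ℝ} {M : LREM n l k} {y : ℤ → S → Fin n → ℝ} {η : ℤ → S → Fin k → ℝ}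
  {W : ℝ → Matrix (Fin n) (Fin n) ℂ} {K : Matrix (Fin k) (Fin r) ℝ} {N : Matrix (Fin r) (Fin l) ℝ}

namespace StableQZ
variable (D : StableQZ M n₁ n₂)

/-- The coordinates, with respect to the basis `K` of `ker (Q₂ Π)`, of the difference between an
expectation error `e` and the linear choice `(H + K N) ζ`, where `H = -(Q₂ Π)† Q₂ Ψ`. -/
def deviation (K : Matrix (Fin k) (Fin r) ℝ) (N : Matrix (Fin r) (Fin l) ℝ) (ζ : Fin l → ℝ)
    (e : Fin k → ℝ) : Fin r → ℝ :=
  pinv K *ᵥ (e - D.Hstd *ᵥ ζ) - N *ᵥ ζ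

theorem deviation_eq (K : Matrix (Fin k) (Fin r) ℝ) (N : Matrix (Fin r) (Fin l) ℝ)
    (ζ : Fin l → ℝ) (e : Fin k → ℝ) :
    D.deviation K N ζ e = (-(pinv K * D.Hstd + N)) *ᵥ ζ + pinv K *ᵥ e := by
  rw [deviation, Matrix.mulVec_sub, Matrix.mulVec_mulVec, Matrix.neg_mulVec, Matrix.add_mulVec]
  abel

theorem deviation_mulVec (hK : IsKerBasis (D.Q₂ * M.Pi) K) (C : Matrix (Fin r) (Fin l) ℝ)
    (ζ : Fin l → ℝ) : D.deviation K N ζ ((D.Hstd + K * (N + C)) *ᵥ ζ) = C *ᵥ ζ := by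
  rw [deviation, Matrix.add_mulVec, add_sub_cancel_left, Matrix.mulVec_mulVec, ← Matrix.mul_assoc,
    pinv_mul_self_eq_one hK.1, Matrix.one_mul, Matrix.add_mulVec, add_sub_cancel_left]

theorem restriction_of_existenceCondition (hE : D.ExistenceCondition)
    (hK : IsKerBasis (D.Q₂ * M.Pi) K) (C : Matrix (Fin r) (Fin l) ℝ) :
    D.Q₂ * (M.Ψ + M.Pi * (D.Hstd + K * C)) = 0 := by
  rw [Matrix.mul_add M.Pi, ← add_assoc, Matrix.mul_add, D.existenceCondition_iff.1 hE, zero_add,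
    ← Matrix.mul_assoc, ← Matrix.mul_assoc, hK.mul_eq_zero, Matrix.zero_mul]

theorem exists_weight_factor (hW : IsWeight W) :
    ∃ R : Matrix (Fin n) (Fin n) ℝ, D.Ξ W = Rᵀ * R := by
  rw [D.Ξ_eq]
  exact (D.isStable_Θ₁.posSemidef_arWeight hW).exists_transpose_mul_self

theorem gram_eq {R : Matrix (Fin n) (Fin n) ℝ} (hR : D.Ξ W = Rᵀ * R) :
    D.gram W K = (R * D.Θν K)ᵀ * (R * D.Θν K) := by
  rw [gram, hR, Matrix.transpose_mul]
  simp only [Matrix.mul_assoc]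

/-- The normal equations of the minimization problem are solvable: with `Ξ = Rᵀ R`, they are those
of the least squares problem for `R Θ_ν N + R Θ_z`. -/
theorem exists_normal_equation (hW : IsWeight W) (K : Matrix (Fin k) (Fin r) ℝ) :
    ∃ N : Matrix (Fin r) (Fin l) ℝ, (D.Θν K)ᵀ * D.Ξ W * D.Θz + D.gram W K * N = 0 := by
  obtain ⟨R, hR⟩ := D.exists_weight_factor hW
  refine ⟨-(pinv (R * D.Θν K) * (R * D.Θz)), ?_⟩
  set X := R * D.Θν K with hX
  have h1 : Xᵀ * (X * pinv X) = Xᵀ := by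
    obtain ⟨h1, -, h3, -⟩ := pinv_penrose X
    rw [← h3, ← Matrix.transpose_mul, h1]
  rw [D.gram_eq hR, ← hX, hR, Matrix.mul_neg]
  have h2 : Xᵀ * X * (pinv X * (R * D.Θz)) = Xᵀ * (R * D.Θz) := by
    conv_rhs => rw [← h1]
    simp only [Matrix.mul_assoc]
  rw [h2, hX, Matrix.transpose_mul]
  simp only [Matrix.mul_assoc, add_neg_cancel]

theorem Λ₁₁_mul_impact : D.Λ₁₁ * D.Z₁ᵀ * D.impact = D.Q₁ := by
  rw [D.impact_eq, Matrix.mul_assoc, ← Matrix.mul_assoc D.Z₁ᵀ, D.Z₁_Z₁, Matrix.one_mul,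
    Matrix.mul_nonsing_inv_cancel_left _ _ D.isUnit_det_Λ₁₁]

theorem eq_zero_of_blocks {v : Fin n → ℝ} (h₁ : D.Q₁ *ᵥ v = 0) (h₂ : D.Q₂ *ᵥ v = 0) : v = 0 := by
  have h : D.Q *ᵥ v = 0 := by
    rw [D.Q_eq, Matrix.fromRows_mulVec, h₁, h₂]
    ext (i | i) <;> rfl
  have := congrArg (D.Qᵀ *ᵥ ·) h
  simpa only [Matrix.mulVec_mulVec, D.Q_orth.1, Matrix.one_mulVec, Matrix.mulVec_zero] using this

theorem Q₁_mul_eq_zero (hU : D.UniquenessCondition) (hK : IsKerBasis (D.Q₂ * M.Pi) K) :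
    D.Q₁ * M.Pi * K = 0 := by
  ext i j
  have hj : K.col j ∈ matKer (D.Q₂ * M.Pi) := by
    rw [← hK.2]; exact Submodule.subset_span ⟨j, rfl⟩
  exact congrFun (show (D.Q₁ * M.Pi) *ᵥ K.col j = 0 from hU hj) i

theorem Θν_eq_zero (hU : D.UniquenessCondition) (hK : IsKerBasis (D.Q₂ * M.Pi) K) :
    D.Θν K = 0 := by
  rw [D.Θν_eq, D.impact_eq]
  simp only [Matrix.mul_assoc]
  rw [← Matrix.mul_assoc D.Q₁, D.Q₁_mul_eq_zero hU hK, Matrix.mul_zero, Matrix.mul_zero]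

end StableQZ

theorem mulVec_eq_zero_of_rank {m : ℕ} {A : Matrix (Fin m) (Fin k) ℝ} (hA : A.rank = k)
    {v : Fin k → ℝ} (hv : A *ᵥ v = 0) : v = 0 := by
  have h := LinearMap.finrank_range_add_finrank_ker A.mulVecLin
  rw [Module.finrank_fin_fun] at h
  have h' : Module.finrank ℝ (LinearMap.range A.mulVecLin) = k := hA
  have hker : LinearMap.ker A.mulVecLin = ⊥ := Submodule.finrank_eq_zero.1 (by omega)
  have : v ∈ LinearMap.ker A.mulVecLin := hv
  rwa [hker] at this

theorem IsSolution.η_eq_deviation [IsProbabilityMeasure μ] (hz : IsShock μ z)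
    (h : IsSolution M μ z y η) (D : StableQZ M n₁ n₂) (hK : IsKerBasis (D.Q₂ * M.Pi) K)
    (N : Matrix (Fin r) (Fin l) ℝ) (t : ℤ) : ∀ᵐ a ∂μ,
      η t a = (D.Hstd + K * N) *ᵥ z t a + K *ᵥ D.deviation K N (z t a) (η t a) := by
  filter_upwards [h.η_eq hz D hK t] with a ha
  rw [StableQZ.deviation, Matrix.mulVec_sub K, Matrix.add_mulVec, Matrix.mulVec_mulVec _ K N]
  rw [add_add_sub_cancel]
  exact ha

theorem IsSolution.impact_eq_deviation [IsProbabilityMeasure μ] (hz : IsShock μ z)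
    (h : IsSolution M μ z y η) (D : StableQZ M n₁ n₂) (hK : IsKerBasis (D.Q₂ * M.Pi) K)
    (N : Matrix (Fin r) (Fin l) ℝ) (t : ℤ) : ∀ᵐ a ∂μ,
      D.impact *ᵥ (M.Ψ *ᵥ z t a + M.Pi *ᵥ η t a) =
        (D.Θz + D.Θν K * N) *ᵥ z t a + D.Θν K *ᵥ D.deviation K N (z t a) (η t a) := by
  filter_upwards [h.η_eq_deviation hz D hK N t] with a ha
  conv_lhs => rw [ha]
  rw [D.Θz_eq, D.Θν_eq]
  simp only [Matrix.mulVec_add, Matrix.add_mulVec, Matrix.mulVec_mulVec, Matrix.mul_add,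
    Matrix.mul_assoc]
  abel

theorem IsSolution.y_eq_deviation [IsProbabilityMeasure μ] (hz : IsShock μ z)
    (h : IsSolution M μ z y η) (D : StableQZ M n₁ n₂) (hK : IsKerBasis (D.Q₂ * M.Pi) K)
    (N : Matrix (Fin r) (Fin l) ℝ) (t : ℤ) : ∀ᵐ a ∂μ, y t a = D.Θ₁ *ᵥ y (t - 1) a +
      ((D.Θz + D.Θν K * N) *ᵥ z t a + D.Θν K *ᵥ D.deviation K N (z t a) (η t a)) := by
  filter_upwards [h.reduced_form hz D t, h.impact_eq_deviation hz D hK N t] with a h1 h2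
  rw [← h2]
  exact h1.2

/-- The spectral density of a solution. -/
theorem IsSolution.isSpectralDensity [IsProbabilityMeasure μ] (hz : IsShock μ z)
    (h : IsSolution M μ z y η) (D : StableQZ M n₁ n₂) :
    IsSpectralDensity μ y (arSpectrum D.Θ₁
      (covMat μ (fun a => D.impact *ᵥ (M.Ψ *ᵥ z 0 a + M.Pi *ᵥ η 0 a))
        fun a => D.impact *ᵥ (M.Ψ *ᵥ z 0 a + M.Pi *ᵥ η 0 a))) :=
  isSpectralDensity_autoregression D.isStable_Θ₁ h.y_stationary h.y_measurable
    (u := fun t a => D.impact *ᵥ (M.Ψ *ᵥ z t a + M.Pi *ᵥ η t a))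
    ((h.disturbance_isInnovation hz M.Ψ M.Pi).mulVec D.impact)
    fun t => (h.reduced_form hz D t).mono fun _ ha => ha.2

theorem IsSolution.deviation_isInnovation [IsProbabilityMeasure μ] (hz : IsShock μ z)
    (h : IsSolution M μ z y η) (D : StableQZ M n₁ n₂) (K : Matrix (Fin k) (Fin r) ℝ)
    (N : Matrix (Fin r) (Fin l) ℝ) :
    IsInnovation μ z fun t a => D.deviation K N (z t a) (η t a) := by
  simp only [D.deviation_eq]
  exact h.disturbance_isInnovation hz _ _

/-- When `N` solves the normal equations, the loss of a solution is a constant plus the weighted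
variance of its deviation: the cross terms vanish. -/
theorem IsSolution.loss_eq [IsProbabilityMeasure μ] (hz : IsShock μ z) (hW : IsWeight W)
    (h : IsSolution M μ z y η) (D : StableQZ M n₁ n₂) (hK : IsKerBasis (D.Q₂ * M.Pi) K)
    (hN : (D.Θν K)ᵀ * D.Ξ W * D.Θz + D.gram W K * N = 0) {R : Matrix (Fin n) (Fin n) ℝ}
    (hR : D.Ξ W = Rᵀ * R) {f : ℝ → Matrix (Fin n) (Fin n) ℂ} (hf : IsSpectralDensity μ y f) :
    loss W f = 1 / 2 * (covMat μ (fun a => (R * (D.Θz + D.Θν K * N)) *ᵥ z 0 a)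
        fun a => (R * (D.Θz + D.Θν K * N)) *ᵥ z 0 a).trace +
      1 / 2 * (covMat μ (fun a => (R * D.Θν K) *ᵥ D.deviation K N (z 0 a) (η 0 a))
        fun a => (R * D.Θν K) *ᵥ D.deviation K N (z 0 a) (η 0 a)).trace := by
  rw [hf.unique (h.isSpectralDensity hz D), D.isStable_Θ₁.loss_arSpectrum hW, ← D.Ξ_eq, hR,
    ← mul_add]
  congr 1
  have hz2 : VecL2 μ (z 0) := hz.memLp 0
  have hd2 : VecL2 μ fun a => D.deviation K N (z 0 a) (η 0 a) :=
    (h.deviation_isInnovation hz D K N).memLp 0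
  set u := fun a => D.impact *ᵥ (M.Ψ *ᵥ z 0 a + M.Pi *ᵥ η 0 a) with hu
  have hu2 : VecL2 μ u := ((h.disturbance_isInnovation hz M.Ψ M.Pi).mulVec D.impact).memLp 0
  set B := R * (D.Θz + D.Θν K * N) with hB
  set X := R * D.Θν K with hX
  have hRu : (fun a => R *ᵥ u a) =ᵐ[μ]
      fun a => B *ᵥ z 0 a + X *ᵥ D.deviation K N (z 0 a) (η 0 a) := by
    filter_upwards [h.impact_eq_deviation hz D hK N 0] with a ha
    rw [hu]
    simp only
    rw [ha, Matrix.mulVec_add, Matrix.mulVec_mulVec, Matrix.mulVec_mulVec]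
  have e1 : (Rᵀ * R * covMat μ u u).trace =
      (covMat μ (fun a => R *ᵥ u a) fun a => R *ᵥ u a).trace := by
    rw [covMat_mulVec_left hu2 (hu2.mulVec R), covMat_mulVec_right hu2 hu2, ← Matrix.mul_assoc,
      Matrix.trace_mul_comm (R * _), ← Matrix.mul_assoc]
  have hXB : Xᵀ * B = 0 := by
    rw [hX, hB, Matrix.transpose_mul, ← hN, StableQZ.gram, hR]
    simp only [Matrix.mul_add, Matrix.mul_assoc]
  have hcross : (covMat μ (fun a => B *ᵥ z 0 a)
      fun a => X *ᵥ D.deviation K N (z 0 a) (η 0 a)).trace = 0 := by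
    rw [covMat_mulVec_left hz2 (hd2.mulVec X), covMat_mulVec_right hz2 hd2, ← Matrix.mul_assoc,
      Matrix.trace_mul_comm, ← Matrix.mul_assoc, hXB, Matrix.zero_mul, Matrix.trace_zero]
  have hcross' : (covMat μ (fun a => X *ᵥ D.deviation K N (z 0 a) (η 0 a))
      fun a => B *ᵥ z 0 a).trace = 0 := by
    rw [← covMat_transpose, Matrix.trace_transpose, hcross]
  have hBz := hz2.mulVec B
  have hXd := hd2.mulVec X
  rw [e1, covMat_congr hRu hRu, covMat_add_left hBz hXd (hBz.add hXd),
    covMat_add_right hBz hBz hXd, covMat_add_right hXd hBz hXd, Matrix.trace_add, Matrix.trace_add,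
    Matrix.trace_add, hcross, hcross', add_zero, zero_add]

/-- The regularized solutions are the solutions whose deviation from the least squares choice of the
expectation errors is not seen by the loss. -/
theorem IsSolution.isRegularized_iff [IsProbabilityMeasure μ] (hz : IsShock μ z) (hW : IsWeight W)
    (h : IsSolution M μ z y η) (D : StableQZ M n₁ n₂) (hK : IsKerBasis (D.Q₂ * M.Pi) K)
    (hN : (D.Θν K)ᵀ * D.Ξ W * D.Θz + D.gram W K * N = 0) :
    IsRegularized M μ z W y η ↔
      ∀ t, ∀ᵐ a ∂μ, D.gram W K *ᵥ D.deviation K N (z t a) (η t a) = 0 := by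
  obtain ⟨R, hR⟩ := D.exists_weight_factor hW
  have hE := h.existenceCondition hz D
  have hinn := h.deviation_isInnovation hz D K N
  constructor
  · rintro ⟨-, f, hf, hmin⟩ t
    -- Compare with the solution `η = (H + K N) z`, which has no deviation.
    obtain ⟨y', hy'⟩ := exists_isSolution hz D (D.restriction_of_existenceCondition hE hK N)
    have hle := hmin _ _ _ hy' (hy'.isSpectralDensity hz D)
    rw [h.loss_eq hz hW D hK hN hR hf,
      hy'.loss_eq hz hW D hK hN hR (hy'.isSpectralDensity hz D)] at hle
    have h0 : ∀ a, (R * D.Θν K) *ᵥ D.deviation K N (z 0 a) ((D.Hstd + K * N) *ᵥ z 0 a) = 0 := by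
      intro a
      have := D.deviation_mulVec (N := N) hK 0 (z 0 a)
      rw [add_zero] at this
      rw [this, Matrix.zero_mulVec, Matrix.mulVec_zero]
    have h1 : (covMat μ (fun a => (R * D.Θν K) *ᵥ
        D.deviation K N (z 0 a) ((D.Hstd + K * N) *ᵥ z 0 a)) fun a => (R * D.Θν K) *ᵥ
        D.deviation K N (z 0 a) ((D.Hstd + K * N) *ᵥ z 0 a)).trace = 0 := by
      simp only [h0]
      simp [Matrix.trace, covMat]
    rw [h1] at hle
    have hX := (hinn.mulVec (R * D.Θν K))
    have hdiag : ∀ i, covMat μ (fun a => (R * D.Θν K) *ᵥ D.deviation K N (z 0 a) (η 0 a))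
        (fun a => (R * D.Θν K) *ᵥ D.deviation K N (z 0 a) (η 0 a)) i i = 0 := by
      have hnn := fun i => covMat_self_diag_nonneg (hX.memLp 0) i
      have hs : (covMat μ (fun a => (R * D.Θν K) *ᵥ D.deviation K N (z 0 a) (η 0 a))
          fun a => (R * D.Θν K) *ᵥ D.deviation K N (z 0 a) (η 0 a)).trace ≤ 0 := by
        linarith
      intro i
      exact (Finset.sum_eq_zero_iff_of_nonneg fun i _ => hnn i).1
        (le_antisymm hs (Finset.sum_nonneg fun i _ => hnn i)) i (Finset.mem_univ i)
    have hst : CovStationary μ fun t a => (R * D.Θν K) *ᵥ D.deviation K N (z t a) (η t a) := by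
      simp only [D.deviation_eq]
      exact (h.mulVec_stationary _ _).map (R * D.Θν K).mulVecLin
    have hz0 := ae_eq_zero_of_covMat_diag (hX.memLp t) (hX.mean t) fun i => by
      have h2 := hst.cov 0 0 t i i
      rw [zero_add] at h2
      exact h2.trans (hdiag i)
    filter_upwards [hz0] with a ha
    rw [D.gram_eq hR, ← Matrix.mulVec_mulVec, ha, Matrix.mulVec_zero]
  · intro h0
    refine ⟨h, _, h.isSpectralDensity hz D, fun y' η' f' hs' hf' => ?_⟩
    rw [h.loss_eq hz hW D hK hN hR (h.isSpectralDensity hz D), hs'.loss_eq hz hW D hK hN hR hf']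
    have h1 : (covMat μ (fun a => (R * D.Θν K) *ᵥ D.deviation K N (z 0 a) (η 0 a))
        fun a => (R * D.Θν K) *ᵥ D.deviation K N (z 0 a) (η 0 a)).trace = 0 := by
      have hX : (fun a => (R * D.Θν K) *ᵥ D.deviation K N (z 0 a) (η 0 a)) =ᵐ[μ] fun _ => 0 := by
        filter_upwards [h0 0] with a ha
        rw [D.gram_eq hR] at ha
        have := congrArg (D.deviation K N (z 0 a) (η 0 a) ⬝ᵥ ·) ha
        beta_reduce at this
        rw [← Matrix.mulVec_mulVec, Matrix.dotProduct_mulVec, Matrix.vecMul_transpose,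
          dotProduct_zero] at this
        exact dotProduct_self_eq_zero.1 this
      rw [covMat_congr hX hX]
      simp [Matrix.trace, covMat]
    have h2 : 0 ≤ (covMat μ (fun a => (R * D.Θν K) *ᵥ D.deviation K N (z 0 a) (η' 0 a))
        fun a => (R * D.Θν K) *ᵥ D.deviation K N (z 0 a) (η' 0 a)).trace :=
      Finset.sum_nonneg fun i _ => covMat_self_diag_nonneg
        (((hs'.deviation_isInnovation hz D K N).mulVec (R * D.Θν K)).memLp 0) i
    rw [h1]
    linarith

/-- A linear solution is regularized when its deviation is in the kernel of `Θ_ν' Ξ Θ_ν`. -/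
theorem exists_isRegularized [IsProbabilityMeasure μ] (hz : IsShock μ z) (hW : IsWeight W)
    (D : StableQZ M n₁ n₂) (hE : D.ExistenceCondition) (hK : IsKerBasis (D.Q₂ * M.Pi) K)
    (hN : (D.Θν K)ᵀ * D.Ξ W * D.Θz + D.gram W K * N = 0) {C : Matrix (Fin r) (Fin l) ℝ}
    (hC : D.gram W K * C = 0) :
    ∃ y, IsRegularized M μ z W y fun t a => (D.Hstd + K * (N + C)) *ᵥ z t a := by
  obtain ⟨y, hy⟩ := exists_isSolution hz D (D.restriction_of_existenceCondition hE hK (N + C))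
  refine ⟨y, (hy.isRegularized_iff hz hW D hK hN).2 fun t => Filter.Eventually.of_forall fun a => ?_⟩
  rw [D.deviation_mulVec hK, Matrix.mulVec_mulVec, hC, Matrix.zero_mulVec]

theorem IsSolution.y_eq_of_uniquenessCondition [IsProbabilityMeasure μ] (hz : IsShock μ z)
    (h : IsSolution M μ z y η) (D : StableQZ M n₁ n₂) (hK : IsKerBasis (D.Q₂ * M.Pi) K)
    (hU : D.UniquenessCondition) (t : ℤ) :
    ∀ᵐ a ∂μ, y t a = D.Θ₁ *ᵥ y (t - 1) a + D.Θz *ᵥ z t a := by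
  filter_upwards [h.y_eq_deviation hz D hK 0 t] with a ha
  rw [D.Θν_eq_zero hU hK] at ha
  simpa using ha

theorem IsRegularized.deviation_eq_zero [IsProbabilityMeasure μ] (hz : IsShock μ z)
    (hW : IsWeight W) (h : IsRegularized M μ z W y η) (D : StableQZ M n₁ n₂)
    (hK : IsKerBasis (D.Q₂ * M.Pi) K)
    (hN : (D.Θν K)ᵀ * D.Ξ W * D.Θz + D.gram W K * N = 0) (hG : IsUnit (D.gram W K)) (t : ℤ) :
    ∀ᵐ a ∂μ, D.deviation K N (z t a) (η t a) = 0 := by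
  filter_upwards [(h.1.isRegularized_iff hz hW D hK hN).1 h t] with a ha
  exact Matrix.mulVec_injective_iff_isUnit.2 hG (by rw [ha, Matrix.mulVec_zero])

theorem StableQZ.normal_equation_of_isUnit (D : StableQZ M n₁ n₂) (hG : IsUnit (D.gram W K)) :
    (D.Θν K)ᵀ * D.Ξ W * D.Θz +
      D.gram W K * (-((D.gram W K)⁻¹ * ((D.Θν K)ᵀ * D.Ξ W * D.Θz))) = 0 := by
  rw [Matrix.mul_neg, Matrix.mul_nonsing_inv_cancel_left _ _
    ((Matrix.isUnit_iff_isUnit_det _).1 hG), add_neg_cancel]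

theorem IsRegularized.representation_of_isUnit [IsProbabilityMeasure μ] (hz : IsShock μ z)
    (hW : IsWeight W) (h : IsRegularized M μ z W y η) (D : StableQZ M n₁ n₂)
    (hK : IsKerBasis (D.Q₂ * M.Pi) K) (hG : IsUnit (D.gram W K)) (t : ℤ) :
    ∀ᵐ a ∂μ, y t a = D.Θ₁ *ᵥ y (t - 1) a + D.Θreg W K *ᵥ z t a ∧
      η t a = D.Hreg W K *ᵥ z t a := by
  have hN := D.normal_equation_of_isUnit hG
  filter_upwards [h.deviation_eq_zero hz hW D hK hN hG t, h.1.y_eq_deviation hz D hK _ t,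
    h.1.η_eq_deviation hz D hK _ t] with a h0 h1 h2
  rw [h0, Matrix.mulVec_zero, add_zero] at h1 h2
  have e1 : D.Θreg W K =
      D.Θz + D.Θν K * -((D.gram W K)⁻¹ * ((D.Θν K)ᵀ * D.Ξ W * D.Θz)) := by
    rw [StableQZ.Θreg, Matrix.sub_mul]
    simp only [Matrix.one_mul, Matrix.mul_neg, Matrix.mul_assoc, sub_eq_add_neg]
  have e2 : D.Hreg W K =
      D.Hstd + K * -((D.gram W K)⁻¹ * ((D.Θν K)ᵀ * D.Ξ W * D.Θz)) := by
    rw [StableQZ.Hreg, StableQZ.Hstd, neg_add]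
    simp only [Matrix.mul_neg, Matrix.mul_assoc]
    abel
  rw [e1, e2]
  exact ⟨h1, h2⟩

theorem IsRegularized.isUnique [IsProbabilityMeasure μ] (hz : IsShock μ z)
    (hW : IsWeight W) (h : IsRegularized M μ z W y η) (D : StableQZ M n₁ n₂)
    (hK : IsKerBasis (D.Q₂ * M.Pi) K) (hc : D.UniquenessCondition ∨ IsUnit (D.gram W K)) :
    IsUniqueRegularized M μ z W y := by
  intro y' η' h' t
  rcases hc with hU | hG
  · exact ae_eq_of_autoregression D.isStable_Θ₁ h'.1.y_stationary h.1.y_stationary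
      (v := fun t a => D.Θz *ᵥ z t a)
      (IsSolution.y_eq_of_uniquenessCondition hz h'.1 D hK hU)
      (IsSolution.y_eq_of_uniquenessCondition hz h.1 D hK hU) t
  · exact ae_eq_of_autoregression D.isStable_Θ₁ h'.1.y_stationary h.1.y_stationary
      (v := fun t a => D.Θreg W K *ᵥ z t a)
      (fun t => (h'.representation_of_isUnit hz hW D hK hG t).mono fun _ ha => ha.1)
      (fun t => (h.representation_of_isUnit hz hW D hK hG t).mono fun _ ha => ha.1) t

/-- If `Θ_ν' Ξ Θ_ν` is singular, then adding a multiple of a shock in the direction of its kernel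
to the expectation errors gives regularized solutions with different `y`, unless `Π` has redundant
columns. -/
theorem isUnit_gram_of_isUnique [IsProbabilityMeasure μ] (hl : 0 < l) (hz : IsShock μ z)
    (hW : IsWeight W) (D : StableQZ M n₁ n₂) (hE : D.ExistenceCondition)
    (hK : IsKerBasis (D.Q₂ * M.Pi) K) (hrank : M.Pi.rank = k)
    (huniq : IsUniqueRegularized M μ z W y) : IsUnit (D.gram W K) := by
  by_contra hG
  rw [Matrix.isUnit_iff_isUnit_det, isUnit_iff_ne_zero, not_not] at hG
  obtain ⟨c, hc, hc0⟩ := Matrix.exists_mulVec_eq_zero_iff.2 hG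
  obtain ⟨N, hN⟩ := D.exists_normal_equation hW K
  set C : Matrix (Fin r) (Fin l) ℝ := Matrix.vecMulVec c (Pi.single ⟨0, hl⟩ 1) with hC
  have hGC : D.gram W K * C = 0 := by
    rw [hC, Matrix.mul_vecMulVec, hc0, Matrix.zero_vecMulVec]
  obtain ⟨y₁, h₁⟩ := exists_isRegularized hz hW D hE hK hN (C := 0) (Matrix.mul_zero _)
  obtain ⟨y₂, h₂⟩ := exists_isRegularized hz hW D hE hK hN hGC
  have hCz : D.Θν K * C = 0 := by
    refine hz.eq_zero_of_mulVec (t := 0) ?_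
    filter_upwards [huniq _ _ h₁ 0, huniq _ _ h₁ (0 - 1), huniq _ _ h₂ 0, huniq _ _ h₂ (0 - 1),
      h₁.1.y_eq_deviation hz D hK N 0, h₂.1.y_eq_deviation hz D hK N 0] with a e1 e1' e2 e2' e3 e4
    rw [D.deviation_mulVec hK, e1, e1', Matrix.zero_mulVec, Matrix.mulVec_zero, add_zero] at e3
    rw [D.deviation_mulVec hK, e2, e2', e3, add_right_inj, Matrix.mulVec_mulVec] at e4
    exact left_eq_add.1 e4
  have hνc : D.Θν K *ᵥ c = 0 := by
    ext i
    have := congrFun (congrFun hCz i) ⟨0, hl⟩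
    rw [hC, Matrix.mul_vecMulVec] at this
    simpa [Matrix.vecMulVec_apply] using this
  -- Hence `Π K c` vanishes in both blocks.
  have hQ₁ : D.Q₁ *ᵥ (M.Pi *ᵥ (K *ᵥ c)) = 0 := by
    rw [D.Θν_eq] at hνc
    have := congrArg ((D.Λ₁₁ * D.Z₁ᵀ) *ᵥ ·) hνc
    simp only [← Matrix.mulVec_mulVec _ _ K, ← Matrix.mulVec_mulVec _ _ M.Pi, Matrix.mulVec_zero]
      at this
    rwa [Matrix.mulVec_mulVec _ _ D.impact, D.Λ₁₁_mul_impact] at this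
  have hQ₂ : D.Q₂ *ᵥ (M.Pi *ᵥ (K *ᵥ c)) = 0 := by
    rw [Matrix.mulVec_mulVec, Matrix.mulVec_mulVec, hK.mul_eq_zero, Matrix.zero_mulVec]
  have hKc : K *ᵥ c = 0 := mulVec_eq_zero_of_rank hrank (D.eq_zero_of_blocks hQ₁ hQ₂)
  exact hc (Matrix.mulVec_injective_iff.2 hK.1 (by rw [hKc, Matrix.mulVec_zero]))

/-- When `Θ_ν = 0`, the standard expectation errors support every regularized `y`. -/
theorem IsRegularized.standard [IsProbabilityMeasure μ] (hz : IsShock μ z)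
    (h : IsRegularized M μ z W y η) (D : StableQZ M n₁ n₂) (hK : IsKerBasis (D.Q₂ * M.Pi) K)
    (hU : D.UniquenessCondition) : IsRegularized M μ z W y fun t a => D.Hstd *ᵥ z t a := by
  refine ⟨⟨h.1.y_measurable, fun t => ?_, hz.condExp_mulVec _, ?_, fun t => ?_⟩, h.2⟩
  · exact measurable_mulVec (measurable_past z le_rfl) _
  · let L : (Fin l ⊕ (Fin n ⊕ Fin k) → ℝ) →ₗ[ℝ] (Fin l ⊕ (Fin n ⊕ Fin k) → ℝ) :=
      LinearMap.pi (Sum.elim (fun i => LinearMap.proj (Sum.inl i))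
        (Sum.elim (fun i => LinearMap.proj (Sum.inr (Sum.inl i)))
          fun i => LinearMap.proj i ∘ₗ D.Hstd.mulVecLin ∘ₗ
            LinearMap.pi fun j => LinearMap.proj (Sum.inl j)))
    have hL := h.1.stationary.map L
    have e : ∀ t a, L (Sum.elim (z t a) (Sum.elim (y t a) (η t a))) =
        Sum.elim (z t a) (Sum.elim (y t a) (D.Hstd *ᵥ z t a)) := by
      intro t a
      ext (i | i | i) <;> rfl
    simpa only [e] using hL
  · filter_upwards [h.1.Z₂_mulVec_eq_zero hz D t, h.1.Z₂_mulVec_eq_zero hz D (t - 1),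
      IsSolution.y_eq_of_uniquenessCondition hz h.1 D hK hU t] with a h1 h2 h3
    rw [add_assoc]
    refine (D.equation_iff h1 h2 _).2 ⟨?_, ?_⟩
    · have := congrArg (· *ᵥ z t a) (D.existenceCondition_iff.1 (h.1.existenceCondition hz D))
      simpa only [Matrix.mul_add, Matrix.add_mulVec, Matrix.mulVec_add, Matrix.mulVec_mulVec,
        Matrix.zero_mulVec] using this
    · rw [h3, D.Θz_eq]
      simp only [Matrix.mul_add, Matrix.add_mulVec, Matrix.mulVec_add, Matrix.mulVec_mulVec]

theorem IsSolution.η_eq_standard [IsProbabilityMeasure μ] (hz : IsShock μ z)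
    (h : IsSolution M μ z y η) (D : StableQZ M n₁ n₂) (hK : IsKerBasis (D.Q₂ * M.Pi) K)
    (hU : D.UniquenessCondition) (hrank : M.Pi.rank = k) (t : ℤ) :
    ∀ᵐ a ∂μ, η t a = D.Hstd *ᵥ z t a := by
  filter_upwards [h.η_eq hz D hK t] with a ha
  have hK0 : ∀ v, K *ᵥ v = 0 := fun v => by
    refine mulVec_eq_zero_of_rank hrank (D.eq_zero_of_blocks ?_ ?_)
    · rw [Matrix.mulVec_mulVec, Matrix.mulVec_mulVec, D.Q₁_mul_eq_zero hU hK, Matrix.zero_mulVec]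
    · rw [Matrix.mulVec_mulVec, Matrix.mulVec_mulVec, hK.mul_eq_zero, Matrix.zero_mulVec]
  rw [hK0, add_zero] at ha
  exact ha

end Regularization

end

theorem theorem2 {n l k : ℕ} (hl : 0 < l) (M : LREM n l k)
    (hdet : ∀ x : ℂ, ‖x‖ = 1 → (toC M.Γ₀ + x • toC M.Γ₁).det ≠ 0)
    {S : Type*} [MeasurableSpace S] (μ : Measure S) [IsProbabilityMeasure μ]
    (z : ℤ → S → Fin l → ℝ) (hz : IsShock μ z)
    (W : ℝ → Matrix (Fin n) (Fin n) ℂ) (hW : IsWeight W) :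
    -- the decomposition that enters the statement exists
    (∃ n₁ n₂ : ℕ, Nonempty (StableQZ M n₁ n₂)) ∧
    -- and for every choice of it and of a basis `K` of `ker (Q₂ Π)`:
    ∀ (n₁ n₂ : ℕ) (D : StableQZ M n₁ n₂) (r : ℕ) (K : Matrix (Fin k) (Fin r) ℝ),
      IsKerBasis (D.Q₂ * M.Pi) K →
      -- existence
      ((∃ y η, IsRegularized M μ z W y η) ↔ D.ExistenceCondition) ∧
      ∀ y η, IsRegularized M μ z W y η →
        -- uniqueness, sufficiency
        (D.UniquenessCondition ∨ IsUnit (D.gram W K) → IsUniqueRegularized M μ z W y) ∧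
        -- uniqueness, necessity
        (M.Pi.rank = k → IsUniqueRegularized M μ z W y →
          D.UniquenessCondition ∨ IsUnit (D.gram W K)) ∧
        -- the representation in the first case
        (D.UniquenessCondition →
          (∀ t, ∀ᵐ a ∂μ, y t a = D.Θ₁ *ᵥ y (t - 1) a + D.Θz *ᵥ z t a) ∧
          IsRegularized M μ z W y (fun t a => D.Hstd *ᵥ z t a) ∧
          (M.Pi.rank = k → ∀ t, ∀ᵐ a ∂μ, η t a = D.Hstd *ᵥ z t a)) ∧
        -- the representation in the second case
        (IsUnit (D.gram W K) →
          (∀ t, ∀ᵐ a ∂μ, y t a = D.Θ₁ *ᵥ y (t - 1) a + D.Θreg W K *ᵥ z t a) ∧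
          (∀ t, ∀ᵐ a ∂μ, η t a = D.Hreg W K *ᵥ z t a)) := by
  refine ⟨exists_stableQZ M hdet, fun n₁ n₂ D r K hK => ⟨⟨?_, fun hE => ?_⟩, fun y η h => ?_⟩⟩
  · rintro ⟨y, η, h⟩
    exact h.1.existenceCondition hz D
  · obtain ⟨N, hN⟩ := D.exists_normal_equation hW K
    obtain ⟨y, hy⟩ := exists_isRegularized hz hW D hE hK hN (C := 0) (Matrix.mul_zero _)
    exact ⟨y, _, hy⟩
  · refine ⟨h.isUnique hz hW D hK, fun hrank huniq => Or.inr ?_, fun hU => ⟨?_, ?_, ?_⟩,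
      fun hG => ⟨fun t => ?_, fun t => ?_⟩⟩
    · exact isUnit_gram_of_isUnique hl hz hW D (h.1.existenceCondition hz D) hK hrank huniq
    · exact IsSolution.y_eq_of_uniquenessCondition hz h.1 D hK hU
    · exact h.standard hz D hK hU
    · exact fun hrank => h.1.η_eq_standard hz D hK hU hrank
    · exact (h.representation_of_isUnit hz hW D hK hG t).mono fun _ ha => ha.1
    · exact (h.representation_of_isUnit hz hW D hK hG t).mono fun _ ha => ha.2
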